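/- An instance of the stable marriage problem with ties consists of $n \ge 1$ men and $n$ women, numbered $0,\dots,n-1$ on each side, each of whom submits a strict weak order (a ranking with ties, a strict partial order in which incomparability is transitive) over all agents of the other side. Its amount of missing information is $\frac{1}{2n}\sum_i \delta_i$, the sum being over all $2n$ agents, where $\delta_i$ is the fraction of the $\binom n2$ pairwise comparisons that cannot be inferred from the order of agent $i$ (for $n=1$ there are no comparisons and $\delta_i=0$). A matching $\mathcal M$ pairs every man with exactly one woman and vice versa. A pair $(m,w)$ with $w \neq \mathcal M(m)$ is a super-blocking pair of $\mathcal M$ if $m$ strictly prefers $w$ to $\mathcal M(m)$ or finds them incomparable, and $w$ strictly prefers $m$ to $\mathcal M(w)$ or finds them incomparable. For $\delta\in[0,1]$, the problem $\delta$-min-bp-super-stable-matching asks, given an instance whose missing information is at most $\delta$, for a matching with the minimum number of super-blocking pairs among all matchings. **Theorem.** An exact solution to $\delta$-min-bp-super-stable-matching can be computed in $O(n^{2(k+1)})$ time, where $k$ is the number of super-blocking pairs in an optimal solution. Precisely: there are a random access machine program $P$ and constants $C, c$ such that, for every $\delta\in[0,1]$, every $n\ge 1$ and every instance with $n$ agents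 on each side and missing information at most $\delta$, the program $P$, run with words of $c(\lfloor\log_2 n\rfloor+1)$ bits and given as input $n$ and, for each agent $i$ and each agent $a$ of the other side, the rank of $a$ for $i$ (the number of agents that $i$ strictly prefers to $a$), halts without overflow after at most $C\,n^{2(k+1)}$ elementary steps and outputs a matching with the minimum number $k$ of super-blocking pairs. Elementary steps are the evaluation of a constant, reads and writes of memory (with computed addresses), addition, truncated subtraction, multiplication, comparison, and branching, at unit cost each; memory cells that hold no input are initially $0$. -/

import Mathlib

/-! ### Stable marriage with ties -/

namespace StableMarriage

/-- A strict weak order on `α`: a strict partial order for which incomparability is transitive.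
`p.pref a b` reads "`a` is strictly preferred to `b`". -/
structure WeakPref (α : Type) where
  pref : α → α → Prop
  strictWeak : IsStrictWeakOrder α pref

namespace WeakPref

variable {α : Type}

/-- `a` and `b` are incomparable (tied). -/
def Incomp (p : WeakPref α) (a b : α) : Prop := ¬ p.pref a b ∧ ¬ p.pref b a

/-- Weak preference: strictly preferred or incomparable. -/
def Weakly (p : WeakPref α) (a b : α) : Prop := p.pref a b ∨ p.Incomp a b

open Classical in
/-- The rank of `a` in the ranking with ties: the number of alternatives strictly preferred
to `a` (so `0` for the alternatives of the top tie). -/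
noncomputable def rank [Fintype α] (p : WeakPref α) (a : α) : ℕ :=
  (Finset.univ.filter fun b => p.pref b a).card

open Classical in
/-- The fraction of the `n.choose 2` pairwise comparisons that cannot be inferred from `p`. -/
noncomputable def missing {n : ℕ} (p : WeakPref (Fin n)) : ℝ :=
  ((Finset.univ.filter fun x : Fin n × Fin n => x.1 < x.2 ∧ p.Incomp x.1 x.2).card : ℝ) /
    (n.choose 2 : ℝ)

end WeakPref

/-- The preferences of `n` men over the `n` women and of the `n` women over the men; both men
and women are numbered `0, …, n - 1`. -/
structure Instance (n : ℕ) where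
  man : Fin n → WeakPref (Fin n)
  woman : Fin n → WeakPref (Fin n)

/-- A matching (of all agents): `M m` is the partner of man `m`, `M.symm w` that of woman `w`. -/
abbrev Matching (n : ℕ) := Fin n ≃ Fin n

namespace Instance

variable {n : ℕ}

/-- The amount of missing information, averaged over the `2 n` agents. -/
noncomputable def missing (I : Instance n) : ℝ :=
  1 / (2 * (n : ℝ)) * (∑ m, (I.man m).missing + ∑ w, (I.woman w).missing)

open Classical in
/-- The super-blocking pairs of `M`: the pairs `(m, w)` that are not matched to each other and
in which each weakly prefers the other over the partner in `M`. -/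
noncomputable def superBP (I : Instance n) (M : Matching n) : Finset (Fin n × Fin n) :=
  Finset.univ.filter fun x =>
    M x.1 ≠ x.2 ∧ (I.man x.1).Weakly x.2 (M x.1) ∧ (I.woman x.2).Weakly x.1 (M.symm x.2)

/-- `M` has the minimum number of super-blocking pairs among all matchings. -/
def IsOptimal (I : Instance n) (M : Matching n) : Prop :=
  ∀ M' : Matching n, (I.superBP M).card ≤ (I.superBP M').card

end Instance

end StableMarriage

/-! ### A word random access machine, programmed with structured control flow -/

namespace RAM

/-- Memory: finitely many arrays are named in a program, `s a i` is the word in cell `i` of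
array `a`. Scalar variables are arrays of which only cell `0` is used. -/
abbrev State := ℕ → ℕ → ℕ

/-- Expressions. `get a e` reads the cell of array `a` whose index is the value of `e`. -/
inductive Expr where
  | const (v : ℕ)
  | get (a : ℕ) (e : Expr)
  | add (e f : Expr)
  | sub (e f : Expr)
  | mul (e f : Expr)
  | lt (e f : Expr)
  | eq (e f : Expr)

namespace Expr

/-- The value of an expression; subtraction is truncated, tests have value `0` or `1`. -/
def eval (s : State) : Expr → ℕ
  | const v => v
  | get a e => s a (e.eval s)
  | add e f => e.eval s + f.eval s
  | sub e f => e.eval s - f.eval s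
  | mul e f => e.eval s * f.eval s
  | lt e f => if e.eval s < f.eval s then 1 else 0
  | eq e f => if e.eval s = f.eval s then 1 else 0

/-- The number of elementary operations in an evaluation. -/
def cost : Expr → ℕ
  | const _ => 1
  | get _ e => e.cost + 1
  | add e f => e.cost + f.cost + 1
  | sub e f => e.cost + f.cost + 1
  | mul e f => e.cost + f.cost + 1
  | lt e f => e.cost + f.cost + 1
  | eq e f => e.cost + f.cost + 1

/-- No overflow: every value (and address) that occurs in the evaluation is a word of `b` bits. -/
def Fits (b : ℕ) (s : State) : Expr → Prop
  | const v => v < 2 ^ b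
  | get a e => e.Fits b s ∧ s a (e.eval s) < 2 ^ b
  | add e f => e.Fits b s ∧ f.Fits b s ∧ e.eval s + f.eval s < 2 ^ b
  | sub e f => e.Fits b s ∧ f.Fits b s
  | mul e f => e.Fits b s ∧ f.Fits b s ∧ e.eval s * f.eval s < 2 ^ b
  | lt e f => e.Fits b s ∧ f.Fits b s ∧ 1 < 2 ^ b
  | eq e f => e.Fits b s ∧ f.Fits b s ∧ 1 < 2 ^ b

end Expr

/-- Programs. `set a i e` stores the value of `e` in cell `i` of array `a`; a condition holds
if its value is not `0`. -/
inductive Prog where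
  | skip
  | set (a : ℕ) (i e : Expr)
  | seq (P Q : Prog)
  | ite (e : Expr) (P Q : Prog)
  | while (e : Expr) (P : Prog)

/-- `Exec b P s t s'`: on a machine with words of `b` bits, the program `P` started in memory
`s` halts after exactly `t` elementary steps with memory `s'`, without any overflow. (A run that
overflows or does not halt has no derivation.) -/
inductive Exec (b : ℕ) : Prog → State → ℕ → State → Prop where
  | skip (s : State) : Exec b Prog.skip s 1 s
  | set (a : ℕ) (i e : Expr) (s : State) (hi : i.Fits b s) (he : e.Fits b s) :
      Exec b (Prog.set a i e) s (i.cost + e.cost + 1)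
        (Function.update s a (Function.update (s a) (i.eval s) (e.eval s)))
  | seq (P Q : Prog) (s s' s'' : State) (t t' : ℕ)
      (hP : Exec b P s t s') (hQ : Exec b Q s' t' s'') : Exec b (Prog.seq P Q) s (t + t') s''
  | ite_true (e : Expr) (P Q : Prog) (s s' : State) (t : ℕ) (he : e.Fits b s)
      (h : e.eval s ≠ 0) (hP : Exec b P s t s') : Exec b (Prog.ite e P Q) s (e.cost + 1 + t) s'
  | ite_false (e : Expr) (P Q : Prog) (s s' : State) (t : ℕ) (he : e.Fits b s)
      (h : e.eval s = 0) (hQ : Exec b Q s t s') : Exec b (Prog.ite e P Q) s (e.cost + 1 + t) s'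
  | while_true (e : Expr) (P : Prog) (s s' s'' : State) (t t' : ℕ) (he : e.Fits b s)
      (h : e.eval s ≠ 0) (hP : Exec b P s t s') (hW : Exec b (Prog.while e P) s' t' s'') :
      Exec b (Prog.while e P) s (e.cost + 1 + t + t') s''
  | while_false (e : Expr) (P : Prog) (s : State) (he : e.Fits b s) (h : e.eval s = 0) :
      Exec b (Prog.while e P) s (e.cost + 1) s

end RAM

namespace StableMarriage

namespace Instance

variable {n : ℕ}

/-- The input memory: array `0` holds `n` in cell `0`, array `1` holds the rank of woman `w` for
man `m` in cell `m * n + w`, array `2` holds the rank of man `m` for woman `w` in cell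
`w * n + m`; all other cells hold `0`. -/
noncomputable def input (I : Instance n) : RAM.State
  | 0, i => if i = 0 then n else 0
  | 1, i => if h : i < n * n then
      (I.man (Fin.divNat ⟨i, h⟩)).rank (Fin.modNat ⟨i, h⟩) else 0
  | 2, i => if h : i < n * n then
      (I.woman (Fin.divNat ⟨i, h⟩)).rank (Fin.modNat ⟨i, h⟩) else 0
  | _, _ => 0

end Instance

/-- The memory `s` presents the matching `M`: cell `m` of array `3` holds the partner of `m`. -/
def Outputs {n : ℕ} (s : RAM.State) (M : Matching n) : Prop :=
  ∀ m : Fin n, s 3 (m : ℕ) = (M m : ℕ)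

end StableMarriage

/-! Guess the set of super-blocking pairs of a solution, delete these pairs, and look for a matching
that uses no deleted pair and whose super-blocking pairs are all deleted. If exactly the
super-blocking pairs of an optimal matching `M₀` are deleted, then `M₀` itself qualifies
(`Instance.feasible`). Conversely, a matching found after deleting at most `k` pairs has at most `k`
super-blocking pairs (`Instance.card_superBP_le`).

The guesses are enumerated as numerals in bijective base `N = n * n`, each digit naming a pair.
Since the number of digits is monotone in the value (`dig_mono`), every numeral up to the one `T` of
an optimal solution has at most `k` digits, so any success up to `T` is optimal. As `T + 1 ≤ 2 * N ^
k` (essentially `numeral_bound`), it remains to treat one guess in `O(n ^ 2)` steps.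

This is done by a proposal algorithm for super-stability. A man proposes to all women of a tie
before he can go on to the next rank; a woman holds a man only while he is strictly the best of her
proposers, and after a tie for the best she holds nobody. A man not held at the end of a level
cannot have a partner of that level in a feasible matching: a rival proposer, at least as good for
her, would form an undeleted super-blocking pair with her (`Levels.lev_le_rank`). So a man who runs
out of levels refutes the guess. If instead every man is held by some woman, counting makes this a
bijection, and it qualifies (`exists_matching`).

For the time bound, linked lists of the women of equal rank are built once; each proposal, change of
level and stack operation then takes constant time, paid by the potential `solvePot`, which starts
at `O(n ^ 2)`. -/

namespace RAM

/-! ### Program logic: total correctness with running times -/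

/-- Memory after writing `v` to cell `i` of array `a`. -/
def wr (s : State) (a i v : ℕ) : State := Function.update s a (Function.update (s a) i v)

@[simp] theorem wr_same (s : State) (a i v : ℕ) : wr s a i v a = Function.update (s a) i v := by
  simp [wr]

theorem wr_ne (s : State) {a a' : ℕ} (i v : ℕ) (h : a' ≠ a) : wr s a i v a' = s a' := by
  simp [wr, h]

/-- The arrays that a program may write to. -/
def Prog.writes : Prog → List ℕ
  | .skip => []
  | .set a _ _ => [a]
  | .seq P Q => P.writes ++ Q.writes
  | .ite _ P Q => P.writes ++ Q.writes
  | .while _ P => P.writes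

/-- The written arrays are read off the syntax, so for a concrete program and array the side
condition is settled by `decide`. -/
theorem Exec.frame {b : ℕ} {P : Prog} {s s' : State} {t : ℕ} (h : Exec b P s t s') :
    ∀ a, a ∉ P.writes → s' a = s a := by
  induction h with
  | skip s => intros; rfl
  | set a i e s hi he =>
    intro a' h
    simp only [Prog.writes, List.mem_singleton] at h
    simp [h]
  | seq P Q s s' s'' t t' hP hQ ihP ihQ =>
    intro a h
    simp only [Prog.writes, List.mem_append, not_or] at h
    rw [ihQ a h.2, ihP a h.1]
  | ite_true e P Q s s' t he h hP ih =>
    intro a h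
    simp only [Prog.writes, List.mem_append, not_or] at h
    exact ih a h.1
  | ite_false e P Q s s' t he h hP ih =>
    intro a h
    simp only [Prog.writes, List.mem_append, not_or] at h
    exact ih a h.2
  | while_true e P s s' s'' t t' he h hP hW ihP ihW =>
    intro a h
    rw [ihW a h, ihP a h]
  | while_false => intros; rfl

/-- Total correctness with time: `P` halts from `s`, and its running time and final memory
satisfy `Q`. -/
def Runs (b : ℕ) (P : Prog) (s : State) (Q : ℕ → State → Prop) : Prop :=
  ∃ t s', Exec b P s t s' ∧ Q t s'

namespace Runs

variable {b : ℕ} {P P' : Prog} {s : State} {Q Q' : ℕ → State → Prop} {e : Expr}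

theorem mono (h : Runs b P s Q) (hQ : ∀ t s', (∀ a, a ∉ P.writes → s' a = s a) → Q t s' → Q' t s') :
    Runs b P s Q' := by
  obtain ⟨t, s', hE, h⟩ := h
  exact ⟨t, s', hE, hQ t s' hE.frame h⟩

theorem skip (h : Q 1 s) : Runs b .skip s Q := ⟨1, s, .skip s, h⟩

theorem set {a : ℕ} {i : Expr} (hi : i.Fits b s) (he : e.Fits b s)
    (h : Q (i.cost + e.cost + 1) (wr s a (i.eval s) (e.eval s))) : Runs b (.set a i e) s Q :=
  ⟨_, _, .set a i e s hi he, h⟩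

theorem seq (h : Runs b P s fun t s' => Runs b P' s' fun t' s'' => Q (t + t') s'') :
    Runs b (.seq P P') s Q := by
  obtain ⟨t, s', hE, t', s'', hE', h⟩ := h
  exact ⟨_, _, .seq P P' s s' s'' t t' hE hE', h⟩

theorem ite (he : e.Fits b s)
    (h1 : e.eval s ≠ 0 → Runs b P s fun t s' => Q (e.cost + 1 + t) s')
    (h2 : e.eval s = 0 → Runs b P' s fun t s' => Q (e.cost + 1 + t) s') :
    Runs b (.ite e P P') s Q := by
  by_cases h : e.eval s = 0
  · obtain ⟨t, s', hE, h'⟩ := h2 h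
    exact ⟨_, _, .ite_false e P P' s s' t he h hE, h'⟩
  · obtain ⟨t, s', hE, h'⟩ := h1 h
    exact ⟨_, _, .ite_true e P P' s s' t he h hE, h'⟩

/-- The rule for loops: the invariant `I φ s` comes with a potential `φ` that pays for the
remaining iterations. -/
theorem loop (I : ℕ → State → Prop) (φ : ℕ) (h0 : I φ s)
    (hstep : ∀ φ s', I φ s' → (∀ a, a ∉ P.writes → s' a = s a) → e.Fits b s' ∧
      (e.eval s' ≠ 0 →
        Runs b P s' fun t s'' => ∃ φ', I φ' s'' ∧ φ' + t + e.cost + 1 ≤ φ)) :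
    Runs b (.while e P) s fun t s' =>
      ∃ φ', I φ' s' ∧ e.eval s' = 0 ∧ t + φ' ≤ φ + e.cost + 1 := by
  suffices H : ∀ φ s', I φ s' → (∀ a, a ∉ P.writes → s' a = s a) →
      Runs b (.while e P) s' fun t s'' =>
        ∃ φ', I φ' s'' ∧ e.eval s'' = 0 ∧ t + φ' ≤ φ + e.cost + 1 from
    H φ s h0 fun _ _ => rfl
  intro φ
  -- Each iteration costs at least one step, so the potential strictly decreases; this also gives
  -- termination.
  induction φ using Nat.strong_induction_on with
  | _ φ ih =>
    intro s' hI hfr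
    obtain ⟨he, hb⟩ := hstep φ s' hI hfr
    by_cases h : e.eval s' = 0
    · exact ⟨_, _, .while_false e P s' he h, φ, hI, h, by omega⟩
    · obtain ⟨t, s'', hE, φ', hI', hφ⟩ := hb h
      obtain ⟨t', s3, hE', φ'', hI'', h0, hφ'⟩ := ih φ' (by omega) s'' hI' fun a ha => by
        rw [hE.frame a ha, hfr a ha]
      exact ⟨_, _, .while_true e P s' s'' s3 t t' he h hE hE', φ'', hI'', h0, by omega⟩

end Runs

/-- A scalar variable. -/
abbrev Expr.var (a : ℕ) : Expr := .get a (.const 0)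

/-- Assignment to a scalar variable. -/
abbrev Prog.asg (a : ℕ) (e : Expr) : Prog := .set a (.const 0) e

end RAM

/-! ### Ranks determine weak preference -/

namespace StableMarriage

namespace WeakPref

variable {n : ℕ} (p : WeakPref (Fin n))

theorem rank_lt_rank {a b : Fin n} (h : p.pref a b) : p.rank a < p.rank b := by
  have := p.strictWeak
  refine Finset.card_lt_card ⟨fun c hc => ?_, fun hs => ?_⟩
  · simp only [Finset.mem_filter, Finset.mem_univ, true_and] at hc ⊢
    exact _root_.trans hc h
  · have := @hs a (by simpa using h)
    simp only [Finset.mem_filter, Finset.mem_univ, true_and] at this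
    exact irrefl a this

/-- Whatever beats one of two tied alternatives beats the other, by transitivity of incomparability.
-/
theorem rank_le_of_incomp {a b : Fin n} (h : p.Incomp a b) : p.rank a ≤ p.rank b := by
  have hp := p.strictWeak
  refine Finset.card_le_card fun c hc => ?_
  simp only [Finset.mem_filter, Finset.mem_univ, true_and] at hc ⊢
  by_contra hcb
  by_cases hbc : p.pref b c
  · exact h.2 (_root_.trans hbc hc)
  · exact (hp.incomp_trans a b c h ⟨hbc, hcb⟩).2 hc

/-- This lets the program, which sees only ranks, test for super-blocking pairs by two comparisons.
-/
theorem weakly_iff {a b : Fin n} : p.Weakly a b ↔ p.rank a ≤ p.rank b := by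
  constructor
  · rintro (h | h)
    · exact (p.rank_lt_rank h).le
    · exact p.rank_le_of_incomp h
  · intro h
    by_cases hab : p.pref a b
    · exact Or.inl hab
    · exact Or.inr ⟨hab, fun hba => (p.rank_lt_rank hba).not_ge h⟩

theorem rank_lt (a : Fin n) : p.rank a < n := by
  have := p.strictWeak
  have h : p.rank a < (Finset.univ : Finset (Fin n)).card :=
    Finset.card_lt_card ⟨Finset.subset_univ _, fun hs => by
      have := hs (Finset.mem_univ a)
      simp only [Finset.mem_filter, Finset.mem_univ, true_and] at this
      exact irrefl a this⟩
  simpa using h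

end WeakPref

/-! ### Numerals in bijective base `N` -/

/-- The digits of `v` in bijective base `N`: digits `1, …, N`, then zeros. -/
def dig (N : ℕ) : ℕ → ℕ → ℕ
  | v, 0 => if v = 0 then 0 else (v - 1) % N + 1
  | v, i + 1 => dig N ((v - 1) / N) i

theorem dig_zero_left (N i : ℕ) : dig N 0 i = 0 := by
  induction i with
  | zero => simp [dig]
  | succ i ih => simpa [dig] using ih

theorem dig_le {N : ℕ} (hN : 0 < N) (v i : ℕ) : dig N v i ≤ N := by
  induction i generalizing v with
  | zero =>
    have := Nat.mod_lt (v - 1) hN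
    simp only [dig]; split_ifs <;> omega
  | succ i ih => exact ih _

/-- The length of a numeral is monotone in its value, so counting upwards visits short numerals
before long ones. -/
theorem dig_mono {N v v' : ℕ} (h : v ≤ v') (i : ℕ) (h0 : dig N v' i = 0) : dig N v i = 0 := by
  induction i generalizing v v' with
  | zero =>
    simp only [dig] at h0 ⊢
    split_ifs at h0 with hv
    rw [if_pos (by omega)]
  | succ i ih => exact ih (Nat.div_le_div_right (by omega)) h0

/-- The value of a numeral, given by the list of its digits minus `1`. -/
def numeral (N : ℕ) : List ℕ → ℕ
  | [] => 0
  | a :: l => a + 1 + N * numeral N l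

theorem dig_numeral {N : ℕ} (l : List ℕ) (hl : ∀ a ∈ l, a < N) (i : ℕ) :
    dig N (numeral N l) i = if h : i < l.length then l[i] + 1 else 0 := by
  induction l generalizing i with
  | nil => simp [numeral, dig_zero_left]
  | cons a l ih =>
    have ha : a < N := hl a (by simp)
    have e : a + 1 + N * numeral N l - 1 = a + N * numeral N l := by omega
    cases i with
    | zero => simp [dig, numeral, e, Nat.mod_eq_of_lt ha]
    | succ i =>
      have e2 : (a + N * numeral N l) / N = numeral N l := by
        rw [Nat.add_mul_div_left _ _ (by omega), Nat.div_eq_of_lt ha, Nat.zero_add]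
      simp only [dig, numeral, e, e2]
      rw [ih fun b hb => hl b (by simp [hb])]
      simp

/-- The largest numeral of length `k` is `N + ... + N ^ k`, which is at most `2 * (N ^ k - 1)`
because `N / (N - 1) ≤ 2`. -/
theorem numeral_bound {N : ℕ} (hN : 2 ≤ N) (l : List ℕ) (hl : ∀ a ∈ l, a < N) :
    numeral N l + 2 ≤ 2 * N ^ l.length := by
  induction l with
  | nil => simp [numeral]
  | cons a l ih =>
    have ha : a < N := hl a (by simp)
    have := ih fun b hb => hl b (by simp [hb])
    have h := Nat.mul_le_mul_left N this
    simp only [numeral, List.length_cons, pow_succ]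
    nlinarith

/-- The carry: the successor of the top digit `N` is `1`, since there is no digit `0` inside a
numeral, and the higher digits are incremented. -/
theorem dig_succ_of_eq {N : ℕ} (hN : 0 < N) (v : ℕ) (h : dig N v 0 = N) :
    dig N (v + 1) 0 = 1 ∧ ∀ j, dig N (v + 1) (j + 1) = dig N ((v - 1) / N + 1) j := by
  simp only [dig] at h
  split_ifs at h with hv
  · omega
  · have h1 : v = N * ((v - 1) / N + 1) := by
      have := Nat.div_add_mod (v - 1) N
      rw [Nat.mul_add]; omega
    refine ⟨?_, fun j => ?_⟩
    · simp only [dig, Nat.add_sub_cancel, Nat.add_eq_zero_iff, one_ne_zero, and_false, if_false]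
      rw [h1, Nat.mul_mod_right]
    · simp only [dig, Nat.add_sub_cancel]
      congr 1
      conv_lhs => rw [h1]
      exact Nat.mul_div_cancel_left _ hN

theorem dig_succ_of_ne {N : ℕ} (hN : 0 < N) (v : ℕ) (h : dig N v 0 ≠ N) :
    dig N (v + 1) 0 = dig N v 0 + 1 ∧ ∀ j, dig N (v + 1) (j + 1) = dig N v (j + 1) := by
  simp only [dig, Nat.add_sub_cancel, Nat.add_eq_zero_iff, one_ne_zero, and_false,
    if_false] at h ⊢
  split_ifs at h ⊢ with hv
  · subst hv; simp
  · have h0 := Nat.div_add_mod (v - 1) N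
    have h2 := Nat.mod_lt (v - 1) hN
    have h1 : v = (v - 1) % N + 1 + N * ((v - 1) / N) := by omega
    have h3 : (v - 1) % N + 1 < N := by omega
    refine ⟨?_, fun j => ?_⟩
    · conv_lhs => rw [h1]
      rw [Nat.add_mul_mod_self_left, Nat.mod_eq_of_lt h3]
    · congr 1
      conv_lhs => rw [h1]
      rw [Nat.add_mul_div_left _ _ hN, Nat.div_eq_of_lt h3, Nat.zero_add]

end StableMarriage

namespace StableMarriage

/-! ### The invariants of the proposal algorithm

Ranks are read from flat arrays: `f (m * n + w)` is the rank of `w` for `m` and `g (w * n + m)` the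
rank of `m` for `w`; the pair `(m, w)` is deleted if `d (m * n + w) ≠ 0`. Man `m` has been through
all women of rank less than `lev m - 1`, and through those of rank `lev m - 1` from number `cur m`
on. Woman `w` has `bst w` as the best rank of a proposal, and holds `m` if `hold w = m + 1`. -/

/-- Man `m` has been through woman `w`. -/
def Reached (n : ℕ) (f lev cur : ℕ → ℕ) (m w : ℕ) : Prop :=
  f (m * n + w) + 1 < lev m ∨ f (m * n + w) + 1 = lev m ∧ cur m ≤ w

/-- The matching `μ` uses no deleted pair, and all its super-blocking pairs are deleted. -/
structure Feasible (n : ℕ) (f g d μ : ℕ → ℕ) : Prop where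
  lt : ∀ m < n, μ m < n
  used : ∀ m < n, d (m * n + μ m) = 0
  block : ∀ m < n, ∀ m' < n, m' ≠ m → f (m' * n + μ m) ≤ f (m' * n + μ m') →
    g (μ m * n + m') ≤ g (μ m * n + m) → d (m' * n + μ m) ≠ 0

/-- `h - 1` is the last argument below `l` at which `F` is `r`; `h = 0` if there is none. -/
structure LastBelow (F : ℕ → ℕ) (r l h : ℕ) : Prop where
  le : h ≤ l
  ne : ∀ w, h ≤ w → w < l → F w ≠ r
  eq : h = 0 ∨ F (h - 1) = r

theorem LastBelow.zero (F : ℕ → ℕ) (r : ℕ) : LastBelow F r 0 0 :=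
  ⟨le_rfl, by omega, Or.inl rfl⟩

theorem LastBelow.succ_of_ne {F : ℕ → ℕ} {r l h : ℕ} (H : LastBelow F r l h) (hr : F l ≠ r) :
    LastBelow F r (l + 1) h :=
  ⟨by have := H.le; omega, fun w h1 h2 => by
    rcases Nat.lt_succ_iff_lt_or_eq.1 h2 with h | rfl
    · exact H.ne w h1 h
    · exact hr, H.eq⟩

theorem LastBelow.succ (F : ℕ → ℕ) (l : ℕ) : LastBelow F (F l) (l + 1) (l + 1) :=
  ⟨le_rfl, by omega, Or.inr rfl⟩

/-- `hd` and `nx` link, for each man and each rank, the women of that rank in decreasing order. -/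
structure Linked (n : ℕ) (f hd nx : ℕ → ℕ) : Prop where
  hd : ∀ m < n, ∀ r < n, LastBelow (fun w => f (m * n + w)) r n (hd (m * n + r))
  nx : ∀ m < n, ∀ w < n, LastBelow (fun w => f (m * n + w)) (f (m * n + w)) w (nx (m * n + w))

/-- The value `lev m = l + 1` means that rank `l` is in progress or finished, and `0` that nothing
has begun; `cur m = w + 1` announces `w` as the next woman, and `cur m = 0` the end of the level.
The field `feas` is the completeness half: no man has gone beyond the rank of his partner in any
feasible matching. -/
structure Levels (n : ℕ) (f g d lev cur : ℕ → ℕ) : Prop where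
  lev_le : ∀ m < n, lev m ≤ n
  cur_le : ∀ m < n, cur m ≤ n
  cur_eq : ∀ m < n, cur m = 0 ∨ f (m * n + (cur m - 1)) + 1 = lev m
  feas : ∀ μ, Feasible n f g d μ → ∀ m < n, lev m ≤ f (m * n + μ m) + 1

/-- `hold` and `bst` are right for the set `P` of proposals. -/
structure Holds (n : ℕ) (g : ℕ → ℕ) (P : ℕ → ℕ → Prop) (hold bst : ℕ → ℕ) : Prop where
  lt : ∀ w < n, ∀ m, hold w = m + 1 → m < n
  mem : ∀ w < n, ∀ m, hold w = m + 1 → P m w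
  best : ∀ w < n, ∀ m, hold w = m + 1 → g (w * n + m) = bst w
  strict : ∀ w < n, ∀ m, hold w = m + 1 → ∀ m' < n, m' ≠ m → P m' w →
    g (w * n + m) < g (w * n + m')
  rej : ∀ w < n, ∀ m < n, P m w → hold w ≠ m + 1 →
    ∃ m' < n, m' ≠ m ∧ P m' w ∧ g (w * n + m') ≤ g (w * n + m)
  bst_le : ∀ w < n, ∀ m < n, P m w → bst w ≤ g (w * n + m)
  -- Ranks are less than `n`, so `bst w = n` serves as the default for a woman without proposals.
  bst_eq : ∀ w < n, bst w < n → ∃ m < n, P m w ∧ g (w * n + m) = bst w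
  bst_lt : ∀ w < n, bst w ≤ n

/-- `hc` counts the women that hold a man. -/
def Counts (n : ℕ) (hold hc : ℕ → ℕ) : Prop :=
  ∀ m < n, hc m = ((Finset.range n).filter fun w => hold w = m + 1).card

/-- The first `sp` cells of `stk` are men, among them all men who are not at rest. -/
structure Stack (n : ℕ) (cur hc stk : ℕ → ℕ) (sp : ℕ) : Prop where
  lt : ∀ i < sp, stk i < n
  mem : ∀ m < n, cur m ≠ 0 ∨ hc m = 0 → ∃ i < sp, stk i = m

/-! ### Preservation of the invariants, and the outcome -/

section

variable {n : ℕ} {f g d lev cur hold bst hc stk : ℕ → ℕ} {P P' : ℕ → ℕ → Prop} {m w h sp : ℕ}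

/-- Opening a level reaches nobody new: `cur` is put just past the last woman of the new rank, and
the old level was already exhausted. -/
theorem reached_level (hc : cur m = 0)
    (hh : LastBelow (fun w => f (m * n + w)) (lev m) n h) {m' w' : ℕ} (hw' : w' < n) :
    Reached n f (Function.update lev m (lev m + 1)) (Function.update cur m h) m' w' ↔
      Reached n f lev cur m' w' := by
  by_cases hm : m' = m
  · subst hm
    have := hh.ne w'
    simp only [Reached, Function.update_self, hc]
    constructor
    · rintro (h1 | h1)
      · omega
      · exact absurd (by omega) (hh.ne w' h1.2 hw')
    · omega
  · simp [Reached, hm]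

/-- No woman of the same rank lies strictly between the old and the new position, so exactly `w` is
added. -/
theorem Levels.reached_step (H : Levels n f g d lev cur) (hm : m < n) (hc : cur m = w + 1)
    (hh : LastBelow (fun w => f (m * n + w)) (f (m * n + w)) w h) {m' w' : ℕ} :
    Reached n f lev (Function.update cur m h) m' w' ↔
      Reached n f lev cur m' w' ∨ m' = m ∧ w' = w := by
  by_cases hm' : m' = m
  · subst hm'
    have h2 := hh.le
    have h3 := H.cur_eq m' hm
    rw [hc] at h3
    simp only [Nat.add_sub_cancel] at h3
    have h4 : f (m' * n + w) + 1 = lev m' := by omega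
    simp only [Reached, Function.update_self, hc, true_and]
    constructor
    · rintro (h5 | h5)
      · exact Or.inl (Or.inl h5)
      · by_cases h6 : w' < w
        · exact absurd (by omega) (hh.ne w' h5.2 h6)
        · omega
    · rintro (h5 | rfl)
      · omega
      · omega
  · simp [Reached, hm']

theorem Levels.not_reached (H : Levels n f g d lev cur) (hm : m < n) (hc : cur m = w + 1) :
    ¬ Reached n f lev cur m w := by
  have h3 := H.cur_eq m hm
  rw [hc] at h3
  simp only [Nat.add_sub_cancel] at h3
  simp only [Reached]
  omega

/-- A man whom nobody holds at the end of a level cannot be married within that level. -/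
theorem Levels.lev_le_rank (H : Levels n f g d lev cur)
    (HH : Holds n g (fun m w => d (m * n + w) = 0 ∧ Reached n f lev cur m w) hold bst)
    (hm : m < n) (hc : cur m = 0) (hfree : ∀ w < n, hold w ≠ m + 1) {μ : ℕ → ℕ}
    (hμ : Feasible n f g d μ) : lev m ≤ f (m * n + μ m) := by
  by_contra hlt
  have h1 := H.feas μ hμ m hm
  -- The partner `μ m` has rank exactly `lev m - 1`, so `m` has proposed to her; as she does not
  -- hold him, there is a rival `m'`.
  obtain ⟨m', hm', hne, ⟨hd, hr⟩, hg⟩ := HH.rej (μ m) (hμ.lt m hm) m hm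
    ⟨hμ.used m hm, Or.inr ⟨by omega, by omega⟩⟩ (hfree _ (hμ.lt m hm))
  have h2 := H.feas μ hμ m' hm'
  -- The rival has not gone beyond the rank of his own partner, hence weakly prefers `μ m`: an
  -- undeleted super-blocking pair.
  refine hμ.block m hm m' hm' hne ?_ hg hd
  simp only [Reached] at hr
  omega

theorem Levels.level (H : Levels n f g d lev cur)
    (HH : Holds n g (fun m w => d (m * n + w) = 0 ∧ Reached n f lev cur m w) hold bst)
    (hm : m < n) (hc : cur m = 0) (hfree : ∀ w < n, hold w ≠ m + 1) (hl : lev m < n)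
    (hh : LastBelow (fun w => f (m * n + w)) (lev m) n h) :
    Levels n f g d (Function.update lev m (lev m + 1)) (Function.update cur m h) := by
  have hf := fun μ (hμ : Feasible n f g d μ) => H.lev_le_rank HH hm hc hfree hμ
  refine ⟨?_, ?_, ?_, ?_⟩
  · intro m' hm'
    have := H.lev_le m' hm'
    simp only [Function.update_apply]; split_ifs <;> omega
  · intro m' hm'
    have := H.cur_le m' hm'
    have := hh.le
    simp only [Function.update_apply]; split_ifs <;> omega
  · intro m' hm'
    have h1 := H.cur_eq m' hm'
    have h2 := hh.eq
    simp only [Function.update_apply]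
    split_ifs with h3
    · subst h3; omega
    · exact h1
  · intro μ hμ m' hm'
    have h1 := H.feas μ hμ m' hm'
    have h2 := hf μ hμ
    simp only [Function.update_apply]
    split_ifs with h3
    · subst h3; omega
    · exact h1

theorem Levels.step (H : Levels n f g d lev cur) (hm : m < n) (hc : cur m = w + 1)
    (hh : LastBelow (fun w => f (m * n + w)) (f (m * n + w)) w h) :
    Levels n f g d lev (Function.update cur m h) := by
  refine ⟨H.lev_le, ?_, ?_, H.feas⟩
  · intro m' hm'
    have h1 := H.cur_le m' hm'
    have h2 := H.cur_le m hm
    have := hh.le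
    simp only [Function.update_apply]; split_ifs <;> omega
  · intro m' hm'
    have h1 := H.cur_eq m' hm'
    have h2 := hh.eq
    simp only [Function.update_apply]
    split_ifs with h3
    · subst h3; rw [hc] at h1; simp only [Nat.add_sub_cancel] at h1; omega
    · exact h1

theorem Holds.congr (H : Holds n g P hold bst) (hP : ∀ m < n, ∀ w < n, (P' m w ↔ P m w)) :
    Holds n g P' hold bst where
  lt := H.lt
  mem w hw m h := (hP m (H.lt w hw m h) w hw).2 (H.mem w hw m h)
  best := H.best
  strict w hw m h m' hm' hne hp := H.strict w hw m h m' hm' hne ((hP m' hm' w hw).1 hp)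
  rej w hw m hm hp h := by
    obtain ⟨m', h1, h2, h3, h4⟩ := H.rej w hw m hm ((hP m hm w hw).1 hp) h
    exact ⟨m', h1, h2, (hP m' h1 w hw).2 h3, h4⟩
  bst_le w hw m hm hp := H.bst_le w hw m hm ((hP m hm w hw).1 hp)
  bst_eq w hw h := by
    obtain ⟨m', h1, h3, h4⟩ := H.bst_eq w hw h
    exact ⟨m', h1, (hP m' h1 w hw).2 h3, h4⟩
  bst_lt := H.bst_lt

/-- The newcomer is rejected with the attained best proposal as witness; anyone held has that best
rank, so he stays strictly best. -/
theorem Holds.reject (H : Holds n g P hold bst)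
    (hP : ∀ m' < n, ∀ w' < n, (P' m' w' ↔ P m' w' ∨ m' = m ∧ w' = w))
    (hw : w < n) (hgn : g (w * n + m) < n) (hg : bst w < g (w * n + m)) :
    Holds n g P' hold bst := by
  refine ⟨H.lt, ?_, H.best, ?_, ?_, ?_, ?_, H.bst_lt⟩
  · intro w' hw' m' h
    exact (hP m' (H.lt w' hw' m' h) w' hw').2 (Or.inl (H.mem w' hw' m' h))
  · intro w' hw' m' h m'' hm'' hne hp
    rcases (hP m'' hm'' w' hw').1 hp with hp | ⟨rfl, rfl⟩
    · exact H.strict w' hw' m' h m'' hm'' hne hp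
    · rw [H.best w' hw' m' h]; exact hg
  · intro w' hw' m' hm' hp h
    rcases (hP m' hm' w' hw').1 hp with hp | ⟨rfl, rfl⟩
    · obtain ⟨m'', h1, h2, h3, h4⟩ := H.rej w' hw' m' hm' hp h
      exact ⟨m'', h1, h2, (hP m'' h1 w' hw').2 (Or.inl h3), h4⟩
    · obtain ⟨m'', h1, h3, h4⟩ := H.bst_eq w' hw' (by omega)
      refine ⟨m'', h1, ?_, (hP m'' h1 w' hw').2 (Or.inl h3), by omega⟩
      rintro rfl; omega
  · intro w' hw' m' hm' hp
    rcases (hP m' hm' w' hw').1 hp with hp | ⟨rfl, rfl⟩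
    · exact H.bst_le w' hw' m' hm' hp
    · exact hg.le
  · intro w' hw' h
    obtain ⟨m'', h1, h3, h4⟩ := H.bst_eq w' hw' h
    exact ⟨m'', h1, (hP m'' h1 w' hw').2 (Or.inl h3), h4⟩

/-- Nobody is strictly best any more. A man held so far is rejected because of the newcomer, and the
newcomer because of an earlier best proposal. Since `bst` is kept, later proposals of the same rank
are not accepted either. -/
theorem Holds.tie (H : Holds n g P hold bst) (hnew : ¬ P m w)
    (hP : ∀ m' < n, ∀ w' < n, (P' m' w' ↔ P m' w' ∨ m' = m ∧ w' = w))
    (hm : m < n) (hw : w < n) (hgn : g (w * n + m) < n) (hg : bst w = g (w * n + m)) :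
    Holds n g P' (Function.update hold w 0) bst := by
  have key : ∀ w' m', Function.update hold w 0 w' = m' + 1 → w' ≠ w ∧ hold w' = m' + 1 := by
    intro w' m' h
    by_cases hw' : w' = w
    · subst hw'; simp at h
    · simpa [hw'] using h
  refine ⟨?_, ?_, ?_, ?_, ?_, ?_, ?_, H.bst_lt⟩
  · intro w' hw' m' h
    exact H.lt w' hw' m' (key w' m' h).2
  · intro w' hw' m' h
    have h := (key w' m' h).2
    exact (hP m' (H.lt w' hw' m' h) w' hw').2 (Or.inl (H.mem w' hw' m' h))
  · intro w' hw' m' h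
    exact H.best w' hw' m' (key w' m' h).2
  · intro w' hw' m' h m'' hm'' hne hp
    obtain ⟨hww, h⟩ := key w' m' h
    rcases (hP m'' hm'' w' hw').1 hp with hp | ⟨rfl, rfl⟩
    · exact H.strict w' hw' m' h m'' hm'' hne hp
    · exact absurd rfl hww
  · intro w' hw' m' hm' hp h
    rcases (hP m' hm' w' hw').1 hp with hp | ⟨rfl, rfl⟩
    · by_cases hh : hold w' = m' + 1
      · have hww : w' = w := by
          by_contra hww
          simp only [Function.update_apply, if_neg hww] at h
          exact h hh
        subst hww
        refine ⟨m, hm, ?_, (hP m hm w' hw').2 (Or.inr ⟨rfl, rfl⟩), ?_⟩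
        · rintro rfl; exact hnew hp
        · rw [H.best w' hw' m' hh, hg]
      · obtain ⟨m'', h1, h2, h3, h4⟩ := H.rej w' hw' m' hm' hp hh
        exact ⟨m'', h1, h2, (hP m'' h1 w' hw').2 (Or.inl h3), h4⟩
    · obtain ⟨m'', h1, h3, h4⟩ := H.bst_eq w' hw' (by omega)
      refine ⟨m'', h1, ?_, (hP m'' h1 w' hw').2 (Or.inl h3), by omega⟩
      rintro rfl; exact hnew h3
  · intro w' hw' m' hm' hp
    rcases (hP m' hm' w' hw').1 hp with hp | ⟨rfl, rfl⟩
    · exact H.bst_le w' hw' m' hm' hp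
    · exact hg.le
  · intro w' hw' h
    obtain ⟨m'', h1, h3, h4⟩ := H.bst_eq w' hw' h
    exact ⟨m'', h1, (hP m'' h1 w' hw').2 (Or.inl h3), h4⟩

theorem Holds.accept (H : Holds n g P hold bst) (hnew : ¬ P m w)
    (hP : ∀ m' < n, ∀ w' < n, (P' m' w' ↔ P m' w' ∨ m' = m ∧ w' = w))
    (hm : m < n) (hw : w < n) (hg : g (w * n + m) < bst w) :
    Holds n g P' (Function.update hold w (m + 1)) (Function.update bst w (g (w * n + m))) := by
  have key : ∀ w' m', Function.update hold w (m + 1) w' = m' + 1 →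
      w' = w ∧ m' = m ∨ w' ≠ w ∧ hold w' = m' + 1 := by
    intro w' m' h
    by_cases hw' : w' = w
    · subst hw'; simp at h; exact Or.inl ⟨rfl, h.symm⟩
    · exact Or.inr (by simpa [hw'] using h)
  refine ⟨?_, ?_, ?_, ?_, ?_, ?_, ?_, ?_⟩
  · intro w' hw' m' h
    rcases key w' m' h with ⟨rfl, rfl⟩ | ⟨hne, h⟩
    · exact hm
    · exact H.lt w' hw' m' h
  · intro w' hw' m' h
    rcases key w' m' h with ⟨rfl, rfl⟩ | ⟨hne, h⟩
    · exact (hP m' hm w' hw').2 (Or.inr ⟨rfl, rfl⟩)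
    · exact (hP m' (H.lt w' hw' m' h) w' hw').2 (Or.inl (H.mem w' hw' m' h))
  · intro w' hw' m' h
    rcases key w' m' h with ⟨rfl, rfl⟩ | ⟨hne, h⟩
    · simp
    · simpa [hne] using H.best w' hw' m' h
  · intro w' hw' m' h m'' hm'' hne hp
    rcases key w' m' h with ⟨rfl, rfl⟩ | ⟨hww, h⟩
    · rcases (hP m'' hm'' w' hw').1 hp with hp | ⟨rfl, -⟩
      · exact hg.trans_le (H.bst_le w' hw' m'' hm'' hp)
      · exact absurd rfl hne
    · rcases (hP m'' hm'' w' hw').1 hp with hp | ⟨rfl, rfl⟩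
      · exact H.strict w' hw' m' h m'' hm'' hne hp
      · exact absurd rfl hww
  · intro w' hw' m' hm' hp h
    rcases (hP m' hm' w' hw').1 hp with hp | ⟨rfl, rfl⟩
    · by_cases hww : w' = w
      · subst hww
        refine ⟨m, hm, ?_, (hP m hm w' hw').2 (Or.inr ⟨rfl, rfl⟩),
          hg.le.trans (H.bst_le w' hw' m' hm' hp)⟩
        rintro rfl; exact hnew hp
      · obtain ⟨m'', h1, h2, h3, h4⟩ := H.rej w' hw' m' hm' hp (by simpa [hww] using h)
        exact ⟨m'', h1, h2, (hP m'' h1 w' hw').2 (Or.inl h3), h4⟩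
    · simp at h
  · intro w' hw' m' hm' hp
    by_cases hww : w' = w
    · subst hww
      rw [Function.update_self]
      rcases (hP m' hm' w' hw').1 hp with hp | ⟨rfl, -⟩
      · exact hg.le.trans (H.bst_le w' hw' m' hm' hp)
      · exact le_rfl
    · rw [Function.update_of_ne hww]
      rcases (hP m' hm' w' hw').1 hp with hp | ⟨-, h⟩
      · exact H.bst_le w' hw' m' hm' hp
      · exact absurd h hww
  · intro w' hw' h
    by_cases hww : w' = w
    · subst hww
      exact ⟨m, hm, (hP m hm w' hw').2 (Or.inr ⟨rfl, rfl⟩), by simp⟩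
    · rw [Function.update_of_ne hww] at h ⊢
      obtain ⟨m'', h1, h3, h4⟩ := H.bst_eq w' hw' h
      exact ⟨m'', h1, (hP m'' h1 w' hw').2 (Or.inl h3), h4⟩
  · intro w' hw'
    have h1 := H.bst_lt w' hw'
    have h2 := H.bst_lt w hw
    simp only [Function.update_apply]; split_ifs <;> omega

theorem Counts.drop (H : Counts n hold hc) (hw : w < n) (hh : hold w = m + 1) :
    Counts n (Function.update hold w 0) (Function.update hc m (hc m - 1)) := by
  intro m' hm'
  by_cases hm : m' = m
  · subst hm
    rw [Function.update_self, H m' hm', ← Finset.card_erase_of_mem (a := w) (by simp [hw, hh])]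
    congr 1
    ext w'
    by_cases hww : w' = w
    · subst hww; simp
    · simp [hww]
  · rw [Function.update_of_ne hm, H m' hm']
    congr 1
    ext w'
    by_cases hww : w' = w
    · subst hww; simp [hh]; omega
    · simp [hww]

theorem Counts.gain (H : Counts n hold hc) (hw : w < n) (hh : hold w = 0) :
    Counts n (Function.update hold w (m + 1)) (Function.update hc m (hc m + 1)) := by
  intro m' hm'
  by_cases hm : m' = m
  · subst hm
    rw [Function.update_self, H m' hm', ← Finset.card_insert_of_notMem (a := w) (by simp [hh])]
    congr 1
    ext w'
    by_cases hww : w' = w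
    · subst hww; simp [hw]
    · simp [hww]
  · rw [Function.update_of_ne hm, H m' hm']
    congr 1
    ext w'
    by_cases hww : w' = w
    · subst hww; simp [hh]; omega
    · simp [hww]

theorem Counts.le (H : Counts n hold hc) (hm : m < n) : hc m ≤ n := by
  rw [H m hm]
  exact (Finset.card_filter_le _ _).trans (by simp)

theorem Counts.free (H : Counts n hold hc) (hm : m < n) (h : hc m = 0) : ∀ w < n, hold w ≠ m + 1 := by
  intro w hw hh
  rw [H m hm, Finset.card_eq_zero, Finset.filter_eq_empty_iff] at h
  exact h (by simpa using hw) hh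

theorem Counts.exists_hold (H : Counts n hold hc) (hm : m < n) (h : hc m ≠ 0) : ∃ w < n, hold w = m + 1 := by
  by_contra! hne
  refine h ?_
  rw [H m hm, Finset.card_eq_zero, Finset.filter_eq_empty_iff]
  exact fun w hw => hne w (by simpa using hw)

open Classical in
/-- The number of pairs that are not in `R`. -/
noncomputable def numMissing (n : ℕ) (R : ℕ → ℕ → Prop) : ℕ :=
  ((Finset.range n ×ˢ Finset.range n).filter fun x => ¬ R x.1 x.2).card

theorem numMissing_le (n : ℕ) (R : ℕ → ℕ → Prop) : numMissing n R ≤ n * n := by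
  classical
  exact (Finset.card_filter_le _ _).trans (by simp)

theorem numMissing_congr (h : ∀ m < n, ∀ w < n, (P' m w ↔ P m w)) :
    numMissing n P' = numMissing n P := by
  classical
  unfold numMissing
  congr 1
  refine Finset.filter_congr fun x hx => ?_
  simp only [Finset.mem_product, Finset.mem_range] at hx
  rw [h _ hx.1 _ hx.2]

theorem numMissing_insert (h : ∀ m' < n, ∀ w' < n, (P' m' w' ↔ P m' w' ∨ m' = m ∧ w' = w))
    (hm : m < n) (hw : w < n) (hnew : ¬ P m w) : numMissing n P' + 1 ≤ numMissing n P := by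
  unfold numMissing
  refine Finset.card_lt_card (Finset.ssubset_iff_of_subset ?_ |>.2 ⟨(m, w), ?_, ?_⟩)
  · intro x
    simp only [Finset.mem_filter, Finset.mem_product, Finset.mem_range]
    rintro ⟨hx, h'⟩
    exact ⟨hx, fun hp => h' ((h _ hx.1 _ hx.2).2 (Or.inl hp))⟩
  · simp [hm, hw, hnew]
  · simp [(h m hm w hw).2 (Or.inr ⟨rfl, rfl⟩)]

/-- When all men are at rest, the women hold a matching whose super-blocking pairs are deleted. -/
theorem exists_matching
    (HH : Holds n g (fun m w => d (m * n + w) = 0 ∧ Reached n f lev cur m w) hold bst)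
    (HC : Counts n hold hc) (HS : Stack n cur hc stk 0) :
    ∃ M : Matching n, (∀ w : Fin n, hold w = (M.symm w : ℕ) + 1) ∧
      ∀ m w : Fin n, w ≠ M m → f (m * n + w) ≤ f (m * n + M m) →
        g (w * n + m) ≤ g (w * n + M.symm w) → d (m * n + w) ≠ 0 := by
  have hrest : ∀ m < n, cur m = 0 ∧ hc m ≠ 0 := by
    intro m hm
    by_contra hne
    obtain ⟨i, hi, -⟩ := HS.mem m hm (by omega)
    omega
  have hex : ∀ m : Fin n, ∃ w : Fin n, hold w = (m : ℕ) + 1 := fun m => by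
    obtain ⟨w, hw, h⟩ := HC.exists_hold m.2 (hrest m m.2).2
    exact ⟨⟨w, hw⟩, h⟩
  choose F hF using hex
  have hinj : Function.Injective F := fun a b hab => by
    have h1 := hF a
    have h2 := hF b
    rw [hab] at h1
    exact Fin.ext (by omega)
  -- A woman holds at most one man, so choosing a holder for each man is injective, hence bijective.
  refine ⟨Equiv.ofBijective F hinj.bijective_of_finite, ?_, ?_⟩
  · intro w
    rw [← hF, ← Equiv.ofBijective_apply F (hf := hinj.bijective_of_finite),
      Equiv.apply_symm_apply]
  · intro m w hne hf hg hd
    generalize hM : Equiv.ofBijective F hinj.bijective_of_finite = M at *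
    have hw : hold w = (M.symm w : ℕ) + 1 := by
      rw [← hF, ← Equiv.ofBijective_apply F (hf := hinj.bijective_of_finite), hM,
        Equiv.apply_symm_apply]
    have hm : hold (M m : ℕ) = (m : ℕ) + 1 := by
      rw [← hF, ← hM]; rfl
    have hr := (HH.mem _ (M m).2 _ hm).2
    -- Man `m` is at the end of the level of `M m` or a later one, so he has reached every woman
    -- whom he weakly prefers to `M m`. If `(m, w)` is not deleted, he proposed to `w`, who holds
    -- someone strictly better.
    refine absurd (HH.strict w w.2 _ hw m m.2 ?_ ⟨hd, ?_⟩) (by omega)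
    · intro h
      exact hne (by rw [Fin.ext h, Equiv.apply_symm_apply])
    · have := (hrest m m.2).1
      simp only [Reached] at hr ⊢
      omega

end

end StableMarriage

namespace StableMarriage

open RAM Expr Prog

/-! ### The program

Arrays `4` and `5` hold the linked lists, `6` the numeral, `7` the deleted pairs, `8` to `13` the
arrays `lev`, `cur`, `hc`, `hold`, `bst` and the stack; the scalars are the height of the stack
(`20`), a counter (`21`), the current man, woman and rank (`22`, `23`, `24`), the flags for failure
and success (`25`, `26`), the start of the current row (`27`) and the dropped man (`28`). -/

/-- Link the women of the same rank, for all men. -/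
def linkBody : Prog :=
  seq (asg 24 (get 1 (add (var 27) (var 23)))) <|
  seq (set 5 (add (var 27) (var 23)) (get 4 (add (var 27) (var 24)))) <|
  seq (set 4 (add (var 27) (var 24)) (add (var 23) (const 1))) <|
  seq (asg 23 (add (var 23) (const 1))) <|
  ite (eq (var 23) (var 0)) (seq (asg 23 (const 0)) (asg 27 (add (var 27) (var 0)))) skip

def linkProg : Prog := .while (lt (var 27) (mul (var 0) (var 0))) linkBody

/-- Woman `w` drops the man that she holds. -/
def dropProg : Prog :=
  ite (get 11 (var 23))
    (seq (asg 28 (sub (get 11 (var 23)) (const 1))) <|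
     seq (set 10 (var 28) (sub (get 10 (var 28)) (const 1))) <|
     seq (set 13 (var 20) (var 28)) <|
     seq (asg 20 (add (var 20) (const 1))) <|
     set 11 (var 23) (const 0))
    skip

/-- Man `m` proposes to woman `w`. -/
def offerProg : Prog :=
  seq (asg 24 (get 2 (add (mul (var 23) (var 0)) (var 22)))) <|
  ite (lt (get 12 (var 23)) (var 24)) skip <|
  seq dropProg <|
  ite (lt (var 24) (get 12 (var 23)))
    (seq (set 12 (var 23) (var 24)) <|
     seq (set 11 (var 23) (add (var 22) (const 1))) <|
     set 10 (var 22) (add (get 10 (var 22)) (const 1)))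
    skip

/-! ### The proposal algorithm for one set of deleted pairs -/

section

variable {n b : ℕ} {s : State}

theorem idx_inj {n m w m' w' : ℕ} (hw : w < n) (hw' : w' < n) (h : m * n + w = m' * n + w') :
    m = m' ∧ w = w' := by
  have h1 : (m * n + w) / n = m := by
    rw [mul_comm, Nat.mul_add_div (by omega), Nat.div_eq_of_lt hw, Nat.add_zero]
  have h2 : (m' * n + w') / n = m' := by
    rw [mul_comm, Nat.mul_add_div (by omega), Nat.div_eq_of_lt hw', Nat.add_zero]
  have : m = m' := by rw [← h1, h, h2]
  subst this
  exact ⟨rfl, by omega⟩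

theorem row_le {n m : ℕ} (h : m < n) : m * n + n ≤ n * n := by
  calc m * n + n = (m + 1) * n := by ring
    _ ≤ n * n := Nat.mul_le_mul_right n h

theorem Stack.update_cur {cur hc stk : ℕ → ℕ} {sp m : ℕ} (H : Stack n cur hc stk sp)
    (hm : ∃ i < sp, stk i = m) (h : ℕ) : Stack n (Function.update cur m h) hc stk sp where
  lt := H.lt
  mem m' hm' hr := by
    by_cases hmm : m' = m
    · exact hmm ▸ hm
    · exact H.mem m' hm' (by simpa [hmm] using hr)

theorem Stack.gain {cur hc stk : ℕ → ℕ} {sp : ℕ} (H : Stack n cur hc stk sp) (m : ℕ) :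
    Stack n cur (Function.update hc m (hc m + 1)) stk sp where
  lt := H.lt
  mem m' hm' hr := by
    refine H.mem m' hm' ?_
    by_cases hmm : m' = m
    · subst hmm; simp at hr; exact Or.inl hr
    · simpa [hmm] using hr

/-- A dropped man is pushed without checking whether he is already there: repetitions are allowed,
only coverage of the men not at rest matters. -/
theorem Stack.drop {cur hc stk : ℕ → ℕ} {sp m : ℕ} (H : Stack n cur hc stk sp) (hm : m < n) :
    Stack n cur (Function.update hc m (hc m - 1)) (Function.update stk sp m) (sp + 1) where
  lt i hi := by
    by_cases h : i = sp
    · simpa [h] using hm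
    · simpa [h] using H.lt i (by omega)
  mem m' hm' hr := by
    by_cases hmm : m' = m
    · exact ⟨sp, by omega, by simp [hmm]⟩
    · obtain ⟨i, hi, h⟩ := H.mem m' hm' (by simpa [hmm] using hr)
      exact ⟨i, by omega, by rw [Function.update_of_ne (by omega), h]⟩

theorem word_ne_zero (hW : 4 * (n * n) + 4 * n + 8 ≤ 2 ^ b) : b ≠ 0 := by
  rintro rfl
  simp only [pow_zero] at hW
  omega

theorem runs_drop (hW : 4 * (n * n) + 4 * n + 8 ≤ 2 ^ b) {w : ℕ} (hw : w < n) (hsw : s 23 0 = w)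
    (hlt : ∀ m, s 11 w = m + 1 → m < n) (hC : Counts n (s 11) (s 10))
    (hS : Stack n (s 9) (s 10) (s 13) (s 20 0)) (hsp : s 20 0 ≤ n + n * n) :
    Runs b dropProg s fun t s' => t ≤ 50 ∧ s' 11 = Function.update (s 11) w 0 ∧
      Counts n (s' 11) (s' 10) ∧ Stack n (s' 9) (s' 10) (s' 13) (s' 20 0) ∧
      s' 20 0 ≤ s 20 0 + 1 := by
  refine Runs.ite ?_ (fun hh => ?_) fun hh => ?_
  · have : s 11 w < 2 ^ b := by
      rcases Nat.eq_zero_or_pos (s 11 w) with h | h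
      · omega
      · have := hlt (s 11 w - 1) (by omega); omega
    simp only [Fits, Expr.eval, hsw]
    omega
  · simp only [Expr.eval, hsw] at hh
    obtain ⟨x, hx⟩ := Nat.exists_eq_succ_of_ne_zero hh
    simp only [Nat.succ_eq_add_one] at hx
    have hxn := hlt x hx
    have hhc := hC.le hxn
    have hb := word_ne_zero hW
    refine Runs.seq (Runs.set ?_ ?_ (Runs.seq (Runs.set ?_ ?_ (Runs.seq (Runs.set ?_ ?_
      (Runs.seq (Runs.set ?_ ?_ (Runs.set ?_ ?_ ?_))))))))
    all_goals simp [Fits, Expr.eval, Expr.cost, wr_ne, hsw, hx]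
    any_goals omega
    exact ⟨hC.drop hw hx, hS.drop hxn⟩
  · simp only [Expr.eval, hsw] at hh
    refine Runs.skip ⟨by simp [Expr.cost], ?_, hC, hS, by omega⟩
    rw [← hh, Function.update_eq_self]

theorem runs_offer (hW : 4 * (n * n) + 4 * n + 8 ≤ 2 ^ b) {m w : ℕ} {P P' : ℕ → ℕ → Prop}
    (h0 : s 0 0 = n) (hg : ∀ i < n * n, s 2 i < n) (hm : m < n) (hw : w < n) (hsm : s 22 0 = m)
    (hsw : s 23 0 = w) (hH : Holds n (s 2) P (s 11) (s 12)) (hnew : ¬ P m w)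
    (hP : ∀ m' < n, ∀ w' < n, (P' m' w' ↔ P m' w' ∨ m' = m ∧ w' = w))
    (hC : Counts n (s 11) (s 10))
    (hS : Stack n (s 9) (s 10) (s 13) (s 20 0)) (hsp : s 20 0 ≤ n + n * n) :
    Runs b offerProg s fun t s' => t ≤ 110 ∧ Holds n (s 2) P' (s' 11) (s' 12) ∧
      Counts n (s' 11) (s' 10) ∧ Stack n (s' 9) (s' 10) (s' 13) (s' 20 0) ∧
      s' 20 0 ≤ s 20 0 + 1 := by
  have hb := word_ne_zero hW
  have hrow := row_le hw
  have hr := hg (w * n + m) (by omega)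
  have hbst := hH.bst_lt w hw
  refine Runs.seq (Runs.set ?_ ?_ ?_)
  · simp [Fits]
  · simp [Fits, Expr.eval, h0, hsm, hsw]; omega
  simp only [Expr.eval, Expr.cost, h0, hsm, hsw]
  generalize hs1 : wr s 24 0 (s 2 (w * n + m)) = s1
  have hfr : ∀ a, a ≠ 24 → s1 a = s a := fun a ha => by rw [← hs1, wr_ne _ _ _ ha]
  have h24 : s1 24 0 = s 2 (w * n + m) := by simp [← hs1]
  refine Runs.ite ?_ (fun hh => ?_) fun hh => ?_
  · simp [Fits, Expr.eval, hfr, hsw, h24]; omega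
  · simp [Expr.eval, hfr, hsw, h24] at hh
    refine Runs.skip ⟨by simp [Expr.cost], ?_, ?_, ?_, ?_⟩
    · simpa [hfr] using hH.reject hP hw hr hh
    · simpa [hfr] using hC
    · simpa [hfr] using hS
    · simp [hfr]
  · simp [Expr.eval, hfr, hsw, h24] at hh
    refine Runs.seq ((runs_drop hW hw (by simp [hfr, hsw]) (by simpa [hfr] using hH.lt w hw)
      (by simpa [hfr] using hC) (by simpa [hfr] using hS) (by simpa [hfr] using hsp)).mono ?_)
    rintro t s2 hfr2 ⟨ht, h11, hC2, hS2, hsp2⟩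
    have e24 : s2 24 0 = s 2 (w * n + m) := by rw [hfr2 24 (by decide), h24]
    have e23 : s2 23 0 = w := by rw [hfr2 23 (by decide), hfr 23 (by decide), hsw]
    have e22 : s2 22 0 = m := by rw [hfr2 22 (by decide), hfr 22 (by decide), hsm]
    have e12 : s2 12 = s 12 := by rw [hfr2 12 (by decide), hfr 12 (by decide)]
    rw [hfr 11 (by decide)] at h11
    rw [hfr 20 (by decide)] at hsp2
    have hhc := hC2.le hm
    refine Runs.ite ?_ (fun hlt => ?_) fun hlt => ?_
    · simp [Fits, Expr.eval, e24, e23, e12]; omega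
    · simp [Expr.eval, e24, e23, e12] at hlt
      refine Runs.seq (Runs.set ?_ ?_ (Runs.seq (Runs.set ?_ ?_ (Runs.set ?_ ?_ ?_))))
      all_goals simp [Fits, Expr.eval, Expr.cost, wr_ne, e22, e23, e24]
      any_goals omega
      refine ⟨by omega, ?_, ?_, hS2.gain m, by omega⟩
      · rw [h11, e12, Function.update_idem]
        exact hH.accept hnew hP hm hw hlt
      · exact hC2.gain hw (by simp [h11])
    · simp [Expr.eval, e24, e23, e12] at hlt
      refine Runs.skip ⟨by simp [Expr.cost]; omega, ?_, hC2, hS2, by omega⟩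
      rw [h11, e12]
      exact hH.tie hnew hP hm hw hr (by omega)

/-- The invariant of the proposal algorithm. -/
structure SolveInv (n : ℕ) (s : State) : Prop where
  levels : Levels n (s 1) (s 2) (s 7) (s 8) (s 9)
  holds : Holds n (s 2) (fun m w => s 7 (m * n + w) = 0 ∧ Reached n (s 1) (s 8) (s 9) m w)
    (s 11) (s 12)
  counts : Counts n (s 11) (s 10)
  stack : Stack n (s 9) (s 10) (s 13) (s 20 0)
  -- A push happens only when a woman drops a man, hence during a new proposal. This bounds the
  -- height of the stack and keeps it within a word.
  small : s 20 0 + numMissing n (Reached n (s 1) (s 8) (s 9)) ≤ n + n * n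

/-- The potential of the proposal algorithm. -/
noncomputable def solvePot (n : ℕ) (s : State) : ℕ :=
  -- A newly reached pair pays for a proposal, including the `40` for a possible push; `70` pays for
  -- opening a level and `40` for a pop.
  250 * numMissing n (Reached n (s 1) (s 8) (s 9)) + 70 * numMissing n (fun m l => l < s 8 m) +
    40 * s 20 0

/-- The input and the linked lists are in memory. -/
structure Ready (n : ℕ) (s : State) : Prop where
  size : s 0 0 = n
  man_lt : ∀ i < n * n, s 1 i < n
  woman_lt : ∀ i < n * n, s 2 i < n
  linked : Linked n (s 1) (s 4) (s 5)

theorem Ready.congr {s' : State} (h : Ready n s) (h0 : s' 0 = s 0) (h1 : s' 1 = s 1)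
    (h2 : s' 2 = s 2) (h4 : s' 4 = s 4) (h5 : s' 5 = s 5) : Ready n s' := by
  constructor
  · rw [h0]; exact h.size
  · rw [h1]; exact h.man_lt
  · rw [h2]; exact h.woman_lt
  · rw [h1, h4, h5]; exact h.linked

/-- Treat the man on top of the stack: he proposes to the next woman of his level, or rests, or
goes on to his next level, or is found to remain single. -/
def solveBody : Prog :=
  seq (asg 22 (get 13 (sub (var 20) (const 1)))) <|
  ite (get 9 (var 22))
    (seq (asg 23 (sub (get 9 (var 22)) (const 1))) <|
     seq (set 9 (var 22) (get 5 (add (mul (var 22) (var 0)) (var 23)))) <|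
     ite (get 7 (add (mul (var 22) (var 0)) (var 23))) skip offerProg) <|
  ite (get 10 (var 22)) (asg 20 (sub (var 20) (const 1))) <|
  ite (lt (get 8 (var 22)) (var 0))
    (seq (set 9 (var 22) (get 4 (add (mul (var 22) (var 0)) (get 8 (var 22))))) <|
     set 8 (var 22) (add (get 8 (var 22)) (const 1)))
    (seq (asg 25 (const 1)) (asg 20 (const 0)))

def solveProg : Prog := .while (var 20) solveBody

/-- The two outcomes are progress and refutation. The extra `3` is the cost of the next test of the
loop. -/
theorem runs_solveBody (hW : 4 * (n * n) + 4 * n + 8 ≤ 2 ^ b) (hR : Ready n s)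
    (hdel : ∀ i < n * n, s 7 i ≤ 1) (hI : SolveInv n s) (h25 : s 25 0 = 0) (hsp : s 20 0 ≠ 0) :
    Runs b solveBody s fun t s' =>
      s' 25 0 = 0 ∧ SolveInv n s' ∧ solvePot n s' + t + 3 ≤ solvePot n s ∨
      s' 25 0 = 1 ∧ s' 20 0 = 0 ∧ (∀ μ, ¬ Feasible n (s 1) (s 2) (s 7) μ) ∧
        t + 3 ≤ solvePot n s := by
  have hb := word_ne_zero hW
  have hsm := hI.small
  obtain ⟨m, hm'⟩ : ∃ m, s 13 (s 20 0 - 1) = m := ⟨_, rfl⟩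
  have hm : m < n := hm' ▸ hI.stack.lt _ (by omega)
  have hrow := row_le hm
  have hcur := hI.levels.cur_le m hm
  have hlev := hI.levels.lev_le m hm
  have hhc := hI.counts.le hm
  have h0 := hR.size
  refine Runs.seq (Runs.set ?_ ?_ (Runs.ite ?_ (fun hc => ?_) fun hc => ?_))
  · simp [Fits]
  · simp [Fits, Expr.eval, hm']; omega
  · simp [Fits, Expr.eval, wr_ne, hm']; omega
  · -- the next woman of the level
    simp only [Expr.eval, wr_same, Function.update_self, hm', wr_ne _ _ _ (by decide : 9 ≠ 22)] at hc
    obtain ⟨w, hw'⟩ := Nat.exists_eq_succ_of_ne_zero hc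
    simp only [Nat.succ_eq_add_one] at hw'
    have hw : w < n := by omega
    have hnx := hR.linked.nx m hm w hw
    have hnl := hnx.le
    have hL := hI.levels.step hm hw' hnx
    have hRe := fun m' w' => hI.levels.reached_step hm hw' hnx (m' := m') (w' := w')
    have hnew := hI.levels.not_reached hm hw'
    have hnum := numMissing_insert (fun m' _ w' _ => hRe m' w') hm hw hnew
    have hd := hdel (m * n + w) (by omega)
    have hSt := hI.stack.update_cur ⟨_, by omega, hm'⟩ (s 5 (m * n + w))
    refine Runs.seq (Runs.set ?_ ?_ (Runs.seq (Runs.set ?_ ?_ ?_)))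
    · simp [Fits]
    · simp [Fits, Expr.eval, wr_ne, hm', hw']; omega
    · simp [Fits, Expr.eval, wr_ne, hm', hw']; omega
    · simp [Fits, Expr.eval, wr_ne, hm', hw', h0]; omega
    simp only [Expr.eval, Expr.cost, hm', hw', h0, wr_same, Function.update_self, wr_ne, ne_eq,
      Nat.reduceEqDiff, not_false_eq_true, Nat.add_sub_cancel,
      OfNat.zero_ne_ofNat]
    generalize hs1 : wr (wr (wr s 22 0 m) 23 0 w) 9 m (s 5 (m * n + w)) = s1
    have e9 : s1 9 = Function.update (s 9) m (s 5 (m * n + w)) := by simp [← hs1, wr_ne]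
    have e22 : s1 22 0 = m := by simp [← hs1, wr_ne]
    have e23 : s1 23 0 = w := by simp [← hs1, wr_ne]
    have hfr : ∀ a, a ≠ 9 → a ≠ 22 → a ≠ 23 → s1 a = s a := fun a h1 h2 h3 => by
      rw [← hs1, wr_ne _ _ _ h1, wr_ne _ _ _ h3, wr_ne _ _ _ h2]
    refine Runs.ite ?_ (fun hdel => ?_) fun hdel => ?_
    · simp [Fits, Expr.eval, e22, e23, hfr, h0]; omega
    · simp [Expr.eval, e22, e23, hfr, h0] at hdel
      refine Runs.skip (Or.inl ⟨by simpa [hfr] using h25, ⟨?_, ?_, ?_, ?_, ?_⟩, ?_⟩)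
      · simpa [hfr, e9] using hL
      · simp only [hfr, e9, hRe, ne_eq, Nat.reduceEqDiff, not_false_eq_true,
          OfNat.one_ne_ofNat]
        -- A deleted pair counts as reached but not as a proposal, so the set of proposals is
        -- unchanged.
        refine hI.holds.congr fun m' _ w' _ => ?_
        constructor
        · rintro ⟨h1, h2 | ⟨rfl, rfl⟩⟩
          · exact ⟨h1, h2⟩
          · exact absurd h1 hdel
        · exact fun h => ⟨h.1, Or.inl h.2⟩
      · simpa [hfr] using hI.counts
      · simpa [hfr, e9] using hSt
      · simp [hfr, e9]; omega
      · simp [solvePot, hfr, e9, Expr.cost]; omega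
    · simp [Expr.eval, e22, e23, hfr, h0] at hdel
      refine (runs_offer hW (P := fun m w => s 7 (m * n + w) = 0 ∧ Reached n (s 1) (s 8) (s 9) m w)
        (P' := fun m w => s 7 (m * n + w) = 0 ∧ Reached n (s1 1) (s1 8) (s1 9) m w)
        (by simp [hfr, h0]) (by simpa [hfr] using hR.woman_lt)
        hm hw e22 e23 (by simpa [hfr] using hI.holds) (fun h => hnew h.2) ?_
        (by simpa [hfr] using hI.counts) (by simpa [hfr, e9] using hSt)
        (by simp [hfr]; omega)).mono ?_
      · intro m' _ w' _
        simp only [hfr, e9, hRe, ne_eq, Nat.reduceEqDiff, not_false_eq_true,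
          OfNat.one_ne_ofNat]
        constructor
        · tauto
        · rintro (h | ⟨rfl, rfl⟩)
          · exact ⟨h.1, Or.inl h.2⟩
          · exact ⟨hdel, Or.inr ⟨rfl, rfl⟩⟩
      · rintro t s2 hfr2 ⟨ht, hH2, hC2, hS2, hsp2⟩
        have f1 : s2 1 = s 1 := by rw [hfr2 1 (by decide)]; simp [hfr]
        have f2 : s2 2 = s 2 := by rw [hfr2 2 (by decide)]; simp [hfr]
        have f7 : s2 7 = s 7 := by rw [hfr2 7 (by decide)]; simp [hfr]
        have f8 : s2 8 = s 8 := by rw [hfr2 8 (by decide)]; simp [hfr]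
        have f9 : s2 9 = Function.update (s 9) m (s 5 (m * n + w)) := by
          rw [hfr2 9 (by decide), e9]
        have f25 : s2 25 = s 25 := by rw [hfr2 25 (by decide)]; simp [hfr]
        rw [hfr 20 (by decide) (by decide) (by decide)] at hsp2
        refine Or.inl ⟨by rw [f25, h25], ⟨?_, ?_, hC2, hS2, ?_⟩, ?_⟩
        · rw [f1, f2, f7, f8, f9]; exact hL
        · rw [f1, f2, f7, f8, f9]
          simpa [hfr, e9] using hH2
        · rw [f1, f8, f9]; omega
        · simp [solvePot, f1, f8, f9, Expr.cost]; omega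
  · simp only [Expr.eval, wr_same, Function.update_self, hm', wr_ne _ _ _ (by decide : 9 ≠ 22)] at hc
    refine Runs.ite ?_ (fun hk => ?_) fun hk => ?_
    · simp [Fits, Expr.eval, wr_ne, hm']; omega
    · -- the man is at rest
      simp only [Expr.eval, wr_same, Function.update_self, hm',
        wr_ne _ _ _ (by decide : 10 ≠ 22)] at hk
      refine Runs.set ?_ ?_ (Or.inl ⟨?_, ⟨?_, ?_, ?_, ?_, ?_⟩, ?_⟩)
      · simp [Fits]
      · simp [Fits, Expr.eval, wr_ne]; omega
      · simpa [wr_ne] using h25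
      · simpa [wr_ne] using hI.levels
      · simpa [wr_ne] using hI.holds
      · simpa [wr_ne] using hI.counts
      · simp [wr_ne, Expr.eval]
        refine ⟨fun i hi => hI.stack.lt i (by omega), fun m' hm2 hr => ?_⟩
        obtain ⟨i, hi, h⟩ := hI.stack.mem m' hm2 hr
        refine ⟨i, ?_, h⟩
        -- The pop could only lose the man on top, who is at rest.
        by_contra hne
        have : i = s 20 0 - 1 := by omega
        subst this
        rw [hm'] at h
        subst h
        omega
      · simp [wr_ne, Expr.eval]; omega
      · simp [solvePot, wr_ne, Expr.eval, Expr.cost]; omega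
    · simp only [Expr.eval, wr_same, Function.update_self, hm',
        wr_ne _ _ _ (by decide : 10 ≠ 22)] at hk
      have hfree := hI.counts.free hm hk
      refine Runs.ite ?_ (fun hl => ?_) fun hl => ?_
      · simp [Fits, Expr.eval, wr_ne, hm', h0]; omega
      · -- the next level
        simp [Expr.eval, wr_ne, hm', h0] at hl
        have hh := hR.linked.hd m hm _ hl
        have hhl := hh.le
        have hL := hI.levels.level hI.holds hm hc hfree hl hh
        have hRe := fun m' w' (hw' : w' < n) => reached_level hc hh (m' := m') hw'
        have hnum := numMissing_congr (fun m' _ w' hw' => hRe m' w' hw')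
        have hnum2 := numMissing_insert (n := n) (m := m) (w := s 8 m) (P := fun m l => l < s 8 m)
          (P' := fun m' l => l < Function.update (s 8) m (s 8 m + 1) m')
          (fun m' _ l _ => by
            by_cases hmm : m' = m
            · subst hmm; simp; omega
            · simp [hmm]) hm hl (by simp)
        have hSt := hI.stack.update_cur ⟨_, by omega, hm'⟩ (s 4 (m * n + s 8 m))
        refine Runs.seq (Runs.set ?_ ?_ (Runs.set ?_ ?_ (Or.inl ⟨?_, ⟨?_, ?_, ?_, ?_, ?_⟩, ?_⟩)))
        · simp [Fits, Expr.eval, hm']; omega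
        · simp [Fits, Expr.eval, wr_ne, hm', h0]; omega
        · simp [Fits, Expr.eval, wr_ne, hm']; omega
        · simp [Fits, Expr.eval, wr_ne, hm', h0]; omega
        · simpa [wr_ne] using h25
        · simpa [wr_ne, Expr.eval, hm', h0] using hL
        · simp [wr_ne, Expr.eval, hm', h0]
          exact hI.holds.congr fun m' _ w' hw' => and_congr_right fun _ => hRe m' w' hw'
        · simpa [wr_ne] using hI.counts
        · simpa [wr_ne, Expr.eval, hm', h0] using hSt
        · simp [wr_ne, Expr.eval, hm', h0]; omega
        · simp [solvePot, wr_ne, Expr.eval, Expr.cost, hm', h0]; omega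
      · -- the man remains single
        simp [Expr.eval, wr_ne, hm', h0] at hl
        refine Runs.seq (Runs.set ?_ ?_ (Runs.set ?_ ?_ (Or.inr ⟨?_, ?_, fun μ hμ => ?_, ?_⟩)))
        · simp [Fits]
        · simp [Fits, hb]
        · simp [Fits]
        · simp [Fits]
        · simp [wr_ne, Expr.eval]
        · simp [Expr.eval]
        · have h1 := hI.levels.lev_le_rank hI.holds hm hc hfree hμ
          have h2 := hμ.lt m hm
          have h3 := hR.man_lt (m * n + μ m) (by omega)
          omega
        · simp [solvePot, Expr.cost]; omega

theorem runs_solve (hW : 4 * (n * n) + 4 * n + 8 ≤ 2 ^ b) (hR : Ready n s)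
    (hdel : ∀ i < n * n, s 7 i ≤ 1) (hI : SolveInv n s) (h25 : s 25 0 = 0) :
    Runs b solveProg s fun t s' => t ≤ solvePot n s + 3 ∧
      (s' 25 0 = 0 ∧ (∃ M : Matching n, (∀ w : Fin n, s' 11 w = (M.symm w : ℕ) + 1) ∧
        ∀ m w : Fin n, w ≠ M m → s 1 (m * n + w) ≤ s 1 (m * n + M m) →
          s 2 (w * n + m) ≤ s 2 (w * n + M.symm w) → s 7 (m * n + w) ≠ 0) ∨
       s' 25 0 = 1 ∧ ∀ μ, ¬ Feasible n (s 1) (s 2) (s 7) μ) := by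
  refine (Runs.loop (fun φ s' => s' 25 0 = 0 ∧ SolveInv n s' ∧ solvePot n s' ≤ φ ∨
    s' 25 0 = 1 ∧ s' 20 0 = 0 ∧ ∀ μ, ¬ Feasible n (s 1) (s 2) (s 7) μ) (solvePot n s)
    (Or.inl ⟨h25, hI, le_rfl⟩) ?_).mono ?_
  · intro φ s' hs' hfr
    have f0 : s' 0 = s 0 := hfr 0 (by decide)
    have f1 : s' 1 = s 1 := hfr 1 (by decide)
    have f2 : s' 2 = s 2 := hfr 2 (by decide)
    have f4 : s' 4 = s 4 := hfr 4 (by decide)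
    have f5 : s' 5 = s 5 := hfr 5 (by decide)
    have f7 : s' 7 = s 7 := hfr 7 (by decide)
    refine ⟨?_, fun h20 => ?_⟩
    · simp [Fits, Expr.eval]
      rcases hs' with ⟨-, hI', -⟩ | ⟨-, h, -⟩
      · have := hI'.small; omega
      · omega
    · simp only [Expr.eval] at h20
      rcases hs' with ⟨h25', hI', hφ⟩ | ⟨-, h, -⟩
      · refine (runs_solveBody hW (hR.congr f0 f1 f2 f4 f5) (by rw [f7]; exact hdel) hI' h25'
          h20).mono ?_
        rintro t s2 - (⟨h1, h2, h3⟩ | ⟨h1, h2, h3, h4⟩)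
        · exact ⟨_, Or.inl ⟨h1, h2, le_rfl⟩, by simp only [Expr.cost]; omega⟩
        · refine ⟨0, Or.inr ⟨h1, h2, ?_⟩, by simp only [Expr.cost]; omega⟩
          rw [← f1, ← f2, ← f7]; exact h3
      · exact absurd h h20
  · rintro t s' hfr ⟨φ', hs', h20, ht⟩
    have f1 : s' 1 = s 1 := hfr 1 (by decide)
    have f2 : s' 2 = s 2 := hfr 2 (by decide)
    have f7 : s' 7 = s 7 := hfr 7 (by decide)
    simp only [Expr.eval] at h20
    refine ⟨by simp only [Expr.cost] at ht; omega, ?_⟩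
    rcases hs' with ⟨h1, hI', -⟩ | ⟨h1, -, h3⟩
    · refine Or.inl ⟨h1, ?_⟩
      have hS := hI'.stack
      rw [h20] at hS
      rw [← f1, ← f2, ← f7]
      exact exists_matching hI'.holds hI'.counts hS
    · exact Or.inr ⟨h1, h3⟩

end

end StableMarriage

/-! ### The remaining subprograms: linking, resetting, counting, output -/

namespace StableMarriage

open RAM Expr Prog

/-- Prepare the arrays and the stack, and mark the pairs in the numeral as deleted. -/
def resetArraysBody : Prog :=
  seq (set 8 (var 21) (const 0)) <|
  seq (set 9 (var 21) (const 0)) <|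
  seq (set 10 (var 21) (const 0)) <|
  seq (set 11 (var 21) (const 0)) <|
  seq (set 12 (var 21) (var 0)) <|
  seq (set 13 (var 21) (var 21)) <|
  asg 21 (add (var 21) (const 1))

def resetArrays : Prog := .while (lt (var 21) (var 0)) resetArraysBody

def clearBody : Prog :=
  seq (set 7 (var 21) (const 0)) (asg 21 (add (var 21) (const 1)))

def clear : Prog := .while (lt (var 21) (mul (var 0) (var 0))) clearBody

def markBody : Prog :=
  seq (set 7 (sub (get 6 (var 21)) (const 1)) (const 1)) (asg 21 (add (var 21) (const 1)))

def mark : Prog := .while (get 6 (var 21)) markBody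

def resetProg : Prog :=
  seq (asg 21 (const 0)) <| seq resetArrays <|
  seq (asg 20 (var 0)) <| seq (asg 25 (const 0)) <|
  seq (asg 21 (const 0)) <| seq clear <|
  seq (asg 21 (const 0)) mark

/-- Go on to the next numeral. -/
def carryBody : Prog :=
  seq (set 6 (var 21) (const 1)) (asg 21 (add (var 21) (const 1)))

def carry : Prog := .while (eq (get 6 (var 21)) (mul (var 0) (var 0))) carryBody

def incrProg : Prog :=
  seq (asg 21 (const 0)) <| seq carry <|
  set 6 (var 21) (add (get 6 (var 21)) (const 1))

/-- Write down the matching. -/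
def writeBody : Prog :=
  seq (set 3 (sub (get 11 (var 21)) (const 1)) (var 21)) (asg 21 (add (var 21) (const 1)))

def writeLoop : Prog := .while (lt (var 21) (var 0)) writeBody

def outputProg : Prog :=
  seq (asg 21 (const 0)) <| seq writeLoop <| asg 26 (const 1)

def searchBody : Prog := seq resetProg <| seq solveProg <| ite (var 25) incrProg outputProg

def searchProg : Prog := .while (eq (var 26) (const 0)) searchBody

section

variable {n b : ℕ} {s : State}

/-- The linked lists, built for the men before `m` and for the women before `w` of man `m`. -/
structure LinkedUpto (n : ℕ) (f hd nx : ℕ → ℕ) (m w : ℕ) : Prop where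
  hd : ∀ m' < n, ∀ r < n, LastBelow (fun w => f (m' * n + w)) r
    (if m' < m then n else if m' = m then w else 0) (hd (m' * n + r))
  nx : ∀ m' < n, ∀ w' < n, m' < m ∨ m' = m ∧ w' < w →
    LastBelow (fun w => f (m' * n + w)) (f (m' * n + w')) w' (nx (m' * n + w'))

/-- Women are put at the head of their list in increasing order, so the previous head is the last
earlier woman of the same rank. -/
theorem LinkedUpto.step {f hd nx : ℕ → ℕ} {m w : ℕ} (H : LinkedUpto n f hd nx m w) (hm : m < n)
    (hw : w < n) (hf : f (m * n + w) < n) :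
    LinkedUpto n f (Function.update hd (m * n + f (m * n + w)) (w + 1))
      (Function.update nx (m * n + w) (hd (m * n + f (m * n + w)))) m (w + 1) where
  hd m' hm' r hr := by
    have h := H.hd m' hm' r hr
    by_cases hmm : m' = m
    · subst hmm
      simp only [lt_irrefl, if_true, if_false] at h ⊢
      by_cases hrr : r = f (m' * n + w)
      · subst hrr
        rw [Function.update_self]
        exact LastBelow.succ (fun w => f (m' * n + w)) w
      · rw [Function.update_of_ne (by omega)]
        exact h.succ_of_ne (Ne.symm hrr)
    · rw [Function.update_of_ne fun he => hmm (idx_inj hr hf he).1]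
      simpa only [if_neg hmm] using h
  nx m' hm' w' hw' hlt := by
    by_cases he : m' = m ∧ w' = w
    · obtain ⟨rfl, rfl⟩ := he
      have h := H.hd m' hm' _ hf
      simp only [lt_irrefl, if_true, if_false] at h
      rwa [Function.update_self]
    · rw [Function.update_of_ne fun h => he (idx_inj hw' hw h)]
      exact H.nx m' hm' w' hw' (by omega)

theorem LinkedUpto.row {f hd nx : ℕ → ℕ} {m : ℕ} (H : LinkedUpto n f hd nx m n) :
    LinkedUpto n f hd nx (m + 1) 0 where
  hd m' hm' r hr := by
    have h := H.hd m' hm' r hr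
    convert h using 1
    split_ifs <;> omega
  nx m' hm' w' hw' hlt := H.nx m' hm' w' hw' (by omega)

theorem runs_link (hW : 4 * (n * n) + 4 * n + 8 ≤ 2 ^ b) (hn : 0 < n) (h0 : s 0 0 = n)
    (h1 : ∀ i < n * n, s 1 i < n) (h4 : s 4 = 0) (h23 : s 23 0 = 0) (h27 : s 27 0 = 0) :
    Runs b linkProg s fun t s' => t ≤ 70 * (n * n) + 9 ∧ Linked n (s 1) (s' 4) (s' 5) := by
  have hb := word_ne_zero hW
  refine (Runs.loop (fun φ s' => ∃ m w, s' 27 0 = m * n ∧ s' 23 0 = w ∧ w < n ∧ m ≤ n ∧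
    LinkedUpto n (s 1) (s' 4) (s' 5) m w ∧ φ + 70 * (m * n + w) = 70 * (n * n)) (70 * (n * n))
    ⟨0, 0, by simpa using h27, h23, hn, by omega, ⟨fun m _ r _ => ?_, by omega⟩, by omega⟩
    ?_).mono ?_
  · simpa [h4] using LastBelow.zero _ _
  · rintro φ s' ⟨m, w, e27, e23, hw, hm, hL, hφ⟩ hfr
    have f0 : s' 0 0 = n := by rw [hfr 0 (by decide), h0]
    have f1 : s' 1 = s 1 := hfr 1 (by decide)
    have hmn : m * n ≤ n * n := Nat.mul_le_mul_right n hm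
    refine ⟨?_, fun hlt => ?_⟩
    · simp [Fits, Expr.eval, e27, f0]; omega
    · simp [Expr.eval, e27, f0] at hlt
      have hm : m < n := by
        by_contra hge
        have : m = n := by omega
        subst this
        omega
      have hrow := row_le hm
      obtain ⟨r, hr'⟩ : ∃ r, s 1 (m * n + w) = r := ⟨_, rfl⟩
      have hr : r < n := hr' ▸ h1 _ (by omega)
      have hhd := (hL.hd m hm r hr).le
      simp only [lt_irrefl, if_true, if_false] at hhd
      have hS := hL.step hm hw (hr'.symm ▸ hr)
      rw [hr'] at hS
      refine Runs.seq (Runs.set ?_ ?_ (Runs.seq (Runs.set ?_ ?_ (Runs.seq (Runs.set ?_ ?_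
        (Runs.seq (Runs.set ?_ ?_ (Runs.ite ?_ (fun he => ?_) fun he => ?_))))))))
      · simp [Fits]
      · simp [Fits, Expr.eval, e27, e23, f1, hr']; omega
      · simp [Fits, Expr.eval, wr_ne, e27, e23]; omega
      · simp [Fits, Expr.eval, wr_ne, e27, e23, f1, hr']; omega
      · simp [Fits, Expr.eval, wr_ne, e27, e23, f1, hr']; omega
      · simp [Fits, Expr.eval, wr_ne, e23]; omega
      · simp [Fits]
      · simp [Fits, Expr.eval, wr_ne, e23]; omega
      · simp [Fits, Expr.eval, wr_ne, e23, f0]; omega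
      · simp [Expr.eval, wr_ne, e23, f0] at he
        refine Runs.seq (Runs.set ?_ ?_ (Runs.set ?_ ?_ ?_))
        · simp [Fits]
        · simp [Fits]
        · simp [Fits]
        · simp [Fits, Expr.eval, wr_ne, e27, f0]; omega
        · rw [he] at hS
          have hmul : (m + 1) * n = m * n + n := by ring
          refine ⟨70 * (n * n) - 70 * (m * n + n), ⟨m + 1, 0, ?_, ?_, hn, hm, ?_, ?_⟩, ?_⟩
          · simp [Expr.eval, wr_ne, e27, f0, hmul]
          · simp [Expr.eval, wr_ne]
          · simpa [Expr.eval, wr_ne, e27, e23, f1, hr', he] using hS.row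
          · omega
          · simp [Expr.cost]; omega
      · simp [Expr.eval, wr_ne, e23, f0] at he
        refine Runs.skip ⟨70 * (n * n) - 70 * (m * n + (w + 1)),
          ⟨m, w + 1, ?_, ?_, by omega, hm.le, ?_, ?_⟩, ?_⟩
        · simp [wr_ne, e27]
        · simp [Expr.eval, wr_ne, e23]
        · simpa [Expr.eval, wr_ne, e27, e23, f1, hr'] using hS
        · omega
        · simp [Expr.cost]; omega
  · rintro t s' hfr ⟨φ', ⟨m, w, e27, e23, hw, hm, hL, hφ⟩, he, ht⟩
    have f0 : s' 0 0 = n := by rw [hfr 0 (by decide), h0]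
    simp only [Expr.eval, e27, f0] at he
    have hmn : m = n := by
      by_contra hne
      have := row_le (show m < n by omega)
      rw [if_pos (by omega)] at he
      omega
    subst hmn
    refine ⟨by simp only [Expr.cost] at ht; omega, ⟨fun m' hm' r hr => ?_, fun m' hm' w' hw' => ?_⟩⟩
    · simpa only [if_pos hm'] using hL.hd m' hm' r hr
    · exact hL.nx m' hm' w' hw' (Or.inl hm')

theorem runs_resetArrays (hW : 4 * (n * n) + 4 * n + 8 ≤ 2 ^ b) (h0 : s 0 0 = n)
    (h21 : s 21 0 = 0) :
    Runs b resetArrays s fun t s' => t ≤ 50 * n + 9 ∧ ∀ i < n, s' 8 i = 0 ∧ s' 9 i = 0 ∧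
      s' 10 i = 0 ∧ s' 11 i = 0 ∧ s' 12 i = n ∧ s' 13 i = i := by
  have hb := word_ne_zero hW
  refine (Runs.loop (fun φ s' => ∃ i, s' 21 0 = i ∧ φ + 50 * i = 50 * n ∧ ∀ j < i, s' 8 j = 0 ∧
    s' 9 j = 0 ∧ s' 10 j = 0 ∧ s' 11 j = 0 ∧ s' 12 j = n ∧ s' 13 j = j) (50 * n)
    ⟨0, h21, by omega, by omega⟩ ?_).mono ?_
  · rintro φ s' ⟨i, e21, hφ, hi⟩ hfr
    have f0 : s' 0 0 = n := by rw [hfr 0 (by decide), h0]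
    refine ⟨by simp [Fits, Expr.eval, e21, f0, hb]; omega, fun hlt => ?_⟩
    simp [Expr.eval, e21, f0] at hlt
    refine Runs.seq (Runs.set ?_ ?_ (Runs.seq (Runs.set ?_ ?_ (Runs.seq (Runs.set ?_ ?_
      (Runs.seq (Runs.set ?_ ?_ (Runs.seq (Runs.set ?_ ?_ (Runs.seq (Runs.set ?_ ?_
      (Runs.set ?_ ?_ ⟨50 * n - 50 * (i + 1), ⟨i + 1, ?_, ?_, fun j hj => ?_⟩, ?_⟩))))))))))))
    all_goals try simp [Fits, Expr.eval, Expr.cost, wr_ne, e21, f0]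
    any_goals omega
    by_cases hji : j = i
    · simp [hji]
    · simpa [hji] using hi j (by omega)
  · rintro t s' hfr ⟨φ', ⟨i, e21, hφ, hi⟩, he, ht⟩
    have f0 : s' 0 0 = n := by rw [hfr 0 (by decide), h0]
    simp [Expr.eval, e21, f0] at he
    exact ⟨by simp [Expr.cost] at ht; omega, fun j hj => hi j (by omega)⟩

theorem runs_clear (hW : 4 * (n * n) + 4 * n + 8 ≤ 2 ^ b) (h0 : s 0 0 = n) (h21 : s 21 0 = 0) :
    Runs b clear s fun t s' => t ≤ 30 * (n * n) + 12 ∧ ∀ i < n * n, s' 7 i = 0 := by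
  have hb := word_ne_zero hW
  refine (Runs.loop (fun φ s' => ∃ i, s' 21 0 = i ∧ φ + 30 * i = 30 * (n * n) ∧
    ∀ j < i, s' 7 j = 0) (30 * (n * n)) ⟨0, h21, by omega, by omega⟩ ?_).mono ?_
  · rintro φ s' ⟨i, e21, hφ, hi⟩ hfr
    have f0 : s' 0 0 = n := by rw [hfr 0 (by decide), h0]
    refine ⟨by simp [Fits, Expr.eval, e21, f0, hb]; omega, fun hlt => ?_⟩
    simp [Expr.eval, e21, f0] at hlt
    refine Runs.seq (Runs.set ?_ ?_
      (Runs.set ?_ ?_ ⟨30 * (n * n) - 30 * (i + 1), ⟨i + 1, ?_, ?_, fun j hj => ?_⟩, ?_⟩))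
    all_goals try simp [Fits, Expr.eval, Expr.cost, wr_ne, e21]
    any_goals omega
    by_cases hji : j = i
    · simp [hji]
    · simpa [hji] using hi j (by omega)
  · rintro t s' hfr ⟨φ', ⟨i, e21, hφ, hi⟩, he, ht⟩
    have f0 : s' 0 0 = n := by rw [hfr 0 (by decide), h0]
    simp [Expr.eval, e21, f0] at he
    exact ⟨by simp [Expr.cost] at ht; omega, fun j hj => hi j (by omega)⟩

/-- The nonzero digits form an initial segment, so the first zero ends the numeral. -/
theorem dig_eq_zero_of_le {N v i j : ℕ} (hij : i ≤ j) (h : dig N v i = 0) : dig N v j = 0 := by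
  induction i generalizing v j with
  | zero =>
    simp only [dig] at h
    split_ifs at h with hv
    rw [hv, dig_zero_left]
  | succ i ih =>
    obtain ⟨j, rfl⟩ : ∃ j', j = j' + 1 := ⟨j - 1, by omega⟩
    exact ih (v := (v - 1) / N) (by omega) h

/-- A digit `i + 1` names cell `i`. The hypothesis `hv` allows at most `n * n` digits, which bounds
the time; repeated digits do no harm. -/
theorem runs_mark (hW : 4 * (n * n) + 4 * n + 8 ≤ 2 ^ b) (hn : 0 < n) {v : ℕ}
    (h6 : s 6 = dig (n * n) v) (hv : dig (n * n) v (n * n) = 0) (h21 : s 21 0 = 0)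
    (h7 : ∀ i < n * n, s 7 i = 0) :
    Runs b mark s fun t s' => t ≤ 30 * (n * n) + 12 ∧ ∀ i < n * n, s' 7 i ≤ 1 ∧
      (s' 7 i ≠ 0 ↔ ∃ j, dig (n * n) v j = i + 1) := by
  have hb := word_ne_zero hW
  have hle := dig_le (N := n * n) (Nat.mul_pos hn hn) v
  refine (Runs.loop (fun φ s' => ∃ i, s' 21 0 = i ∧ i ≤ n * n ∧ φ + 30 * i = 30 * (n * n) ∧
    ∀ p < n * n, s' 7 p ≤ 1 ∧ (s' 7 p ≠ 0 ↔ ∃ j < i, dig (n * n) v j = p + 1)) (30 * (n * n))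
    ⟨0, h21, by omega, by omega, fun p hp => by simp [h7 p hp]⟩ ?_).mono ?_
  · rintro φ s' ⟨i, e21, hin, hφ, hi⟩ hfr
    have f6 : s' 6 = dig (n * n) v := by rw [hfr 6 (by decide), h6]
    have hd := hle i
    refine ⟨by simp [Fits, Expr.eval, e21, f6]; omega, fun hne => ?_⟩
    simp [Expr.eval, e21, f6] at hne
    have hlt : i < n * n := by
      by_contra hge
      exact hne (dig_eq_zero_of_le (by omega) hv)
    refine Runs.seq (Runs.set ?_ ?_
      (Runs.set ?_ ?_ ⟨30 * (n * n) - 30 * (i + 1), ⟨i + 1, ?_, ?_, ?_, fun p hp => ?_⟩, ?_⟩))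
    all_goals try simp only [Fits, Expr.eval, Expr.cost, wr_ne, wr_same, Function.update_self, e21, f6,
      ne_eq, Nat.reduceEqDiff, not_false_eq_true]
    any_goals omega
    obtain ⟨h1, h2⟩ := hi p hp
    by_cases hpd : p = dig (n * n) v i - 1
    · rw [hpd, Function.update_self]
      exact ⟨le_rfl, fun _ => ⟨i, by omega, by omega⟩, fun _ => one_ne_zero⟩
    · rw [Function.update_of_ne hpd]
      refine ⟨h1, h2.trans ⟨fun ⟨j, hj, h⟩ => ⟨j, by omega, h⟩, fun ⟨j, hj, h⟩ => ⟨j, ?_, h⟩⟩⟩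
      by_contra hge
      have : j = i := by omega
      subst this
      omega
  · rintro t s' hfr ⟨φ', ⟨i, e21, hin, hφ, hi⟩, he, ht⟩
    have f6 : s' 6 = dig (n * n) v := by rw [hfr 6 (by decide), h6]
    simp [Expr.eval, e21, f6] at he
    refine ⟨by simp [Expr.cost] at ht; omega, fun p hp => ?_⟩
    obtain ⟨h1, h2⟩ := hi p hp
    refine ⟨h1, h2.trans ⟨fun ⟨j, hj, h⟩ => ⟨j, h⟩, fun ⟨j, h⟩ => ⟨j, ?_, h⟩⟩⟩
    by_contra hge
    have := dig_eq_zero_of_le (show i ≤ j by omega) he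
    omega

theorem runs_reset (hW : 4 * (n * n) + 4 * n + 8 ≤ 2 ^ b) (hn : 0 < n) (h0 : s 0 0 = n) {v : ℕ}
    (h6 : s 6 = dig (n * n) v) (hv : dig (n * n) v (n * n) = 0) :
    Runs b resetProg s fun t s' => t ≤ 200 * (n * n) ∧ s' 25 0 = 0 ∧
      (∀ i < n * n, s' 7 i ≤ 1 ∧ (s' 7 i ≠ 0 ↔ ∃ j, dig (n * n) v j = i + 1)) ∧
      SolveInv n s' ∧ solvePot n s' ≤ 360 * (n * n) := by
  have hb := word_ne_zero hW
  have hnn : n ≤ n * n := Nat.le_mul_of_pos_left n hn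
  refine Runs.seq (Runs.set ?_ ?_ (Runs.seq ((runs_resetArrays hW ?_ ?_).mono ?_)))
  · simp [Fits]
  · simp [Fits]
  · simpa [wr_ne] using h0
  · simp [Expr.eval]
  rintro t1 s1 hfr1 ⟨ht1, hs1⟩
  have f0 : s1 0 0 = n := by rw [hfr1 0 (by decide)]; simpa [wr_ne] using h0
  have f6 : s1 6 = s 6 := by rw [hfr1 6 (by decide)]; simp [wr_ne]
  refine Runs.seq (Runs.set ?_ ?_ (Runs.seq (Runs.set ?_ ?_ (Runs.seq (Runs.set ?_ ?_
    (Runs.seq ((runs_clear hW ?_ ?_).mono ?_)))))))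
  any_goals simp [Fits, Expr.eval, wr_ne, f0]
  · omega
  generalize hs2 : wr (wr (wr s1 20 0 n) 25 0 0) 21 0 0 = s2
  have g20 : s2 20 0 = n := by simp [← hs2, wr_ne]
  have g25 : s2 25 0 = 0 := by simp [← hs2, wr_ne]
  have gfr : ∀ a, a ≠ 20 → a ≠ 25 → a ≠ 21 → s2 a = s1 a := fun a h1 h2 h3 => by
    rw [← hs2, wr_ne _ _ _ h3, wr_ne _ _ _ h2, wr_ne _ _ _ h1]
  rintro t3 s3 hfr3 ht3 h7
  refine Runs.seq (Runs.set ?_ ?_ ((runs_mark hW hn (v := v) ?_ hv ?_ ?_).mono ?_))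
  · simp [Fits]
  · simp [Fits]
  · rw [wr_ne _ _ _ (by decide), hfr3 6 (by decide), gfr 6 (by decide) (by decide) (by decide),
      f6, h6]
  · simp [Expr.eval]
  · simpa [wr_ne] using h7
  rintro t4 s4 hfr4 ⟨ht4, h74⟩
  have fr : ∀ a, a ∉ [7, 20, 21, 25] → s4 a = s1 a := fun a ha => by
    simp only [List.mem_cons, List.not_mem_nil, or_false, not_or] at ha
    rw [hfr4 a (by simp [markBody, mark, writes, ha]), wr_ne _ _ _ ha.2.2.1,
      hfr3 a (by simp [clearBody, clear, writes, ha]), gfr a ha.2.1 ha.2.2.2 ha.2.2.1]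
  have e20 : s4 20 0 = n := by
    rw [hfr4 20 (by decide), wr_ne _ _ _ (by decide), hfr3 20 (by decide), g20]
  have e25 : s4 25 0 = 0 := by
    rw [hfr4 25 (by decide), wr_ne _ _ _ (by decide), hfr3 25 (by decide), g25]
  have hs4 : ∀ i < n, s4 8 i = 0 ∧ s4 9 i = 0 ∧ s4 10 i = 0 ∧ s4 11 i = 0 ∧ s4 12 i = n ∧
      s4 13 i = i := by
    simp only [fr 8 (by decide), fr 9 (by decide), fr 10 (by decide), fr 11 (by decide),
      fr 12 (by decide), fr 13 (by decide)]
    exact hs1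
  -- With all `lev` equal to `0` nothing is reached, so the clauses about proposals hold vacuously.
  have hnr : ∀ m < n, ∀ w, ¬ Reached n (s4 1) (s4 8) (s4 9) m w := fun m hm w => by
    have := (hs4 m hm).1
    simp only [Reached]; omega
  have hn1 := numMissing_le n (Reached n (s4 1) (s4 8) (s4 9))
  have hn2 := numMissing_le n (fun m l => l < s4 8 m)
  refine ⟨by simp only [Expr.cost]; omega, e25, h74, ⟨⟨?_, ?_, ?_, ?_⟩,
    ⟨?_, ?_, ?_, ?_, ?_, ?_, ?_, ?_⟩, ?_, ⟨?_, ?_⟩, by omega⟩, by simp only [solvePot]; omega⟩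
  · intro m hm; have := hs4 m hm; omega
  · intro m hm; have := hs4 m hm; omega
  · intro m hm; have := hs4 m hm; omega
  · intro μ _ m hm; have := hs4 m hm; omega
  · intro w hw m h; have := hs4 w hw; omega
  · intro w hw m h; have := hs4 w hw; omega
  · intro w hw m h; have := hs4 w hw; omega
  · intro w hw m h; have := hs4 w hw; omega
  · intro w hw m hm h; exact absurd h.2 (hnr m hm w)
  · intro w hw m hm h; exact absurd h.2 (hnr m hm w)
  · intro w hw h; have := hs4 w hw; omega
  · intro w hw; have := hs4 w hw; omega
  · intro m hm
    rw [(hs4 m hm).2.2.1, eq_comm, Finset.card_eq_zero, Finset.filter_eq_empty_iff]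
    intro w hw h
    have := hs4 w (by simpa using hw)
    omega
  · intro i hi; have := hs4 i (by omega); omega
  · intro m hm _
    exact ⟨m, by omega, (hs4 m hm).2.2.2.2.2⟩

theorem runs_incr (hW : 4 * (n * n) + 4 * n + 8 ≤ 2 ^ b) (hn : 0 < n) (h0 : s 0 0 = n) {v : ℕ}
    (h6 : s 6 = dig (n * n) v) (hv : dig (n * n) v (n * n) = 0) :
    Runs b incrProg s fun t s' => t ≤ 60 * (n * n) ∧ s' 6 = dig (n * n) (v + 1) := by
  have hb := word_ne_zero hW
  have hN : 0 < n * n := Nat.mul_pos hn hn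
  have hle := dig_le hN v
  -- Here `u` is the value of the digits of `v` from position `i` on. Below `i` the digits of `v +
  -- 1` are in place, and from `i` on they are those of `u + 1`.
  refine Runs.seq (Runs.set ?_ ?_ (Runs.seq ((Runs.loop (fun φ s' => ∃ i u, s' 21 0 = i ∧
    i ≤ n * n ∧ φ + 30 * i = 30 * (n * n) ∧ (∀ j, s' 6 (i + j) = dig (n * n) u j) ∧
    (∀ j, s' 6 (i + j) = dig (n * n) v (i + j)) ∧
    (∀ j < i, s' 6 j = dig (n * n) (v + 1) j) ∧
    ∀ j, dig (n * n) (v + 1) (i + j) = dig (n * n) (u + 1) j) (30 * (n * n))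
    ⟨0, v, by simp [Expr.eval], by omega, by omega, by simp [wr_ne, h6], by simp [wr_ne, h6],
      by omega, by simp⟩ ?_).mono ?_)))
  · simp [Fits]
  · simp [Fits]
  · rintro φ s' ⟨i, u, e21, hin, hφ, hu, hv', hi, hu'⟩ hfr
    have f0 : s' 0 0 = n := by rw [hfr 0 (by decide)]; simpa [wr_ne] using h0
    have hd : s' 6 i ≤ n * n := by rw [← Nat.add_zero i, hv']; exact hle _
    refine ⟨by simp [Fits, Expr.eval, e21, f0]; omega, fun he => ?_⟩
    simp [Expr.eval, e21, f0] at he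
    have hlt : i < n * n := by
      by_contra hge
      have := dig_eq_zero_of_le (show n * n ≤ i + 0 by omega) hv
      rw [← hv', Nat.add_zero] at this
      omega
    have hu0 : dig (n * n) u 0 = n * n := by rw [← hu, Nat.add_zero, he]
    obtain ⟨hc0, hcs⟩ := dig_succ_of_eq hN u hu0
    refine Runs.seq (Runs.set ?_ ?_ (Runs.set ?_ ?_ ⟨30 * (n * n) - 30 * (i + 1),
      ⟨i + 1, (u - 1) / (n * n), ?_, ?_, ?_, fun j => ?_, fun j => ?_, fun j hj => ?_,
        fun j => ?_⟩, ?_⟩))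
    all_goals try simp only [Fits, Expr.eval, Expr.cost, wr_ne, wr_same, Function.update_self, e21,
      ne_eq, Nat.reduceEqDiff, not_false_eq_true]
    any_goals omega
    · rw [Function.update_of_ne (by omega), Nat.add_right_comm, Nat.add_assoc, hu]
      rfl
    · rw [Function.update_of_ne (by omega), Nat.add_right_comm, Nat.add_assoc, hv']
    · by_cases hji : j = i
      · rw [hji, Function.update_self, ← Nat.add_zero i, hu', hc0]
      · rw [Function.update_of_ne hji]; exact hi j (by omega)
    · rw [Nat.add_right_comm, Nat.add_assoc, hu', hcs]
  · rintro t s' hfr ⟨φ', ⟨i, u, e21, hin, hφ, hu, hv', hi, hu'⟩, he, ht⟩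
    have f0 : s' 0 0 = n := by rw [hfr 0 (by decide)]; simpa [wr_ne] using h0
    have hd : s' 6 i ≤ n * n := by rw [← Nat.add_zero i, hv']; exact hle _
    simp [Expr.eval, e21, f0] at he
    have hu0 : dig (n * n) u 0 ≠ n * n := by rw [← hu, Nat.add_zero]; exact he
    obtain ⟨hc0, hcs⟩ := dig_succ_of_ne hN u hu0
    refine Runs.set ?_ ?_ ⟨?_, ?_⟩
    · simp [Fits, Expr.eval, e21]; omega
    · simp [Fits, Expr.eval, e21]; omega
    · simp [Expr.cost] at ht ⊢; omega
    · funext j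
      simp only [Expr.eval, wr_same, e21]
      by_cases hji : j = i
      · rw [hji, Function.update_self, ← Nat.add_zero i, hu', hu, hc0]
      · rw [Function.update_of_ne hji]
        by_cases hlt : j < i
        · exact hi j hlt
        · obtain ⟨k, rfl⟩ : ∃ k, j = i + (k + 1) := ⟨j - i - 1, by omega⟩
          rw [hu', hu, hcs]

theorem runs_output (hW : 4 * (n * n) + 4 * n + 8 ≤ 2 ^ b) (hn : 0 < n) (h0 : s 0 0 = n)
    {M : Matching n} (hM : ∀ w : Fin n, s 11 w = (M.symm w : ℕ) + 1) :
    Runs b outputProg s fun t s' => t ≤ 60 * n ∧ s' 26 0 = 1 ∧ Outputs s' M := by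
  have hb := word_ne_zero hW
  refine Runs.seq (Runs.set ?_ ?_ (Runs.seq ((Runs.loop (fun φ s' => ∃ i, s' 21 0 = i ∧
    φ + 30 * i = 30 * n ∧ ∀ m : Fin n, (M m : ℕ) < i → s' 3 m = (M m : ℕ)) (30 * n)
    ⟨0, by simp [Expr.eval], by omega, by omega⟩ ?_).mono ?_)))
  · simp [Fits]
  · simp [Fits]
  · rintro φ s' ⟨i, e21, hφ, hi⟩ hfr
    have f0 : s' 0 0 = n := by rw [hfr 0 (by decide)]; simpa [wr_ne] using h0
    have f11 : s' 11 = s 11 := by rw [hfr 11 (by decide)]; simp [wr_ne]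
    refine ⟨by simp [Fits, Expr.eval, e21, f0, hb]; omega, fun hlt => ?_⟩
    simp [Expr.eval, e21, f0] at hlt
    have hMi := hM ⟨i, hlt⟩
    simp only at hMi
    have := (M.symm ⟨i, hlt⟩).2
    refine Runs.seq (Runs.set ?_ ?_
      (Runs.set ?_ ?_ ⟨30 * n - 30 * (i + 1), ⟨i + 1, ?_, ?_, fun m hm => ?_⟩, ?_⟩))
    all_goals try simp only [Fits, Expr.eval, Expr.cost, wr_ne, wr_same, Function.update_self, e21, f11,
      hMi, ne_eq, Nat.reduceEqDiff, not_false_eq_true]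
    any_goals omega
    rw [Nat.add_sub_cancel]
    by_cases hmi : (M m : ℕ) = i
    · have : m = M.symm ⟨i, hlt⟩ := by
        rw [Equiv.eq_symm_apply]; exact Fin.ext hmi
      rw [← this, Function.update_self, hmi]
    · rw [Function.update_of_ne, hi m (by omega)]
      intro h
      apply hmi
      rw [Fin.ext h, Equiv.apply_symm_apply]
  · rintro t s' hfr ⟨φ', ⟨i, e21, hφ, hi⟩, he, ht⟩
    have f0 : s' 0 0 = n := by rw [hfr 0 (by decide)]; simpa [wr_ne] using h0
    simp [Expr.eval, e21, f0] at he
    refine Runs.set ?_ ?_ ⟨?_, ?_, fun m => ?_⟩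
    · simp [Fits]
    · simp [Fits, hb]
    · simp [Expr.cost] at ht ⊢; omega
    · simp [Expr.eval]
    · rw [wr_ne _ _ _ (by decide)]
      exact hi m (by have := (M m).2; omega)

end

end StableMarriage

/-! ### The search over numerals, and optimality -/

namespace StableMarriage

open RAM Expr Prog

section

variable {n b : ℕ} {s : State}

/-- What the search computes: a matching whose super-blocking pairs are among the digits of a
numeral that is at most `T`. -/
def Found (n T : ℕ) (f g : ℕ → ℕ) (s : State) : Prop :=
  ∃ M : Matching n, Outputs s M ∧ ∃ v ≤ T, ∀ m w : Fin n, w ≠ M m →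
    f (m * n + w) ≤ f (m * n + M m) → g (w * n + m) ≤ g (w * n + M.symm w) →
      ∃ j, dig (n * n) v j = m * n + w + 1

/-- By `hfeas` the guess `T` cannot be refuted, so the search ends there at the latest. Each guess
costs at most `1000 * (n * n)`: resetting, solving, and either counting on or writing the output. -/
theorem runs_search (hW : 4 * (n * n) + 4 * n + 8 ≤ 2 ^ b) (hn : 0 < n) (hR : Ready n s)
    (h6 : s 6 = 0) (h26 : s 26 0 = 0) {T : ℕ} (hT : dig (n * n) T (n * n) = 0)
    (hfeas : ∀ d : ℕ → ℕ, (∀ i < n * n, d i ≠ 0 ↔ ∃ j, dig (n * n) T j = i + 1) →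
      ∃ μ, Feasible n (s 1) (s 2) d μ) :
    Runs b searchProg s fun t s' => t ≤ 1000 * (n * n) * (T + 1) + 5 ∧
      Found n T (s 1) (s 2) s' := by
  have hb := word_ne_zero hW
  have hnn : n ≤ n * n := Nat.le_mul_of_pos_left n hn
  refine (Runs.loop (fun φ s' => s' 26 0 = 0 ∧ (∃ v ≤ T, s' 6 = dig (n * n) v ∧
      φ + 1000 * (n * n) * v = 1000 * (n * n) * (T + 1)) ∨
    s' 26 0 = 1 ∧ Found n T (s 1) (s 2) s') (1000 * (n * n) * (T + 1))
    (Or.inl ⟨h26, 0, by omega, ?_, by omega⟩) ?_).mono ?_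
  · funext i; rw [h6, dig_zero_left]; rfl
  · intro φ s0 hI hfr
    refine ⟨?_, fun hc => ?_⟩
    · simp [Fits, Expr.eval, hb]; omega
    replace hc : s0 26 0 = 0 := by
      by_contra h
      exact hc (if_neg h)
    rcases hI with ⟨-, v, hvT, h6v, hφ⟩ | ⟨h1, -⟩
    swap
    · omega
    have hv0 := dig_mono hvT (n * n) hT
    have hR0 : Ready n s0 := hR.congr (hfr 0 (by decide)) (hfr 1 (by decide)) (hfr 2 (by decide))
      (hfr 4 (by decide)) (hfr 5 (by decide))
    have f1 : s0 1 = s 1 := hfr 1 (by decide)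
    have f2 : s0 2 = s 2 := hfr 2 (by decide)
    refine Runs.seq ((runs_reset hW hn hR0.size h6v hv0).mono ?_)
    rintro t1 s1 hfr1 ⟨ht1, h25, h7, hI1, hpot⟩
    have hR1 : Ready n s1 := hR0.congr (hfr1 0 (by decide)) (hfr1 1 (by decide))
      (hfr1 2 (by decide)) (hfr1 4 (by decide)) (hfr1 5 (by decide))
    have g1 : s1 1 = s 1 := (hfr1 1 (by decide)).trans f1
    have g2 : s1 2 = s 2 := (hfr1 2 (by decide)).trans f2
    refine Runs.seq ((runs_solve hW hR1 (fun i hi => (h7 i hi).1) hI1 h25).mono ?_)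
    rintro t2 s2 hfr2 ⟨ht2, hres⟩
    have k0 : s2 0 0 = n := by rw [hfr2 0 (by decide)]; exact hR1.size
    have k6 : s2 6 = dig (n * n) v := by
      rw [hfr2 6 (by decide), hfr1 6 (by decide), h6v]
    refine Runs.ite ?_ (fun hf => ?_) fun hf => ?_
    · simp [Fits, Expr.eval]; omega
    · simp only [Expr.eval] at hf
      rcases hres with ⟨h, -⟩ | ⟨-, hno⟩
      · exact absurd h hf
      -- A refuted guess is not `T`, so the successor is still at most `T`.
      have hvT' : v < T := by
        refine lt_of_le_of_ne hvT ?_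
        rintro rfl
        obtain ⟨μ, hμ⟩ := hfeas (s1 7) fun i hi => (h7 i hi).2
        rw [← g1, ← g2] at hμ
        exact hno μ hμ
      refine (runs_incr hW hn k0 k6 hv0).mono ?_
      rintro t3 s3 hfr3 ⟨ht3, h63⟩
      have h263 : s3 26 0 = 0 := by
        rw [hfr3 26 (by decide), hfr2 26 (by decide), hfr1 26 (by decide), hc]
      have hmul : 1000 * (n * n) * (v + 1) = 1000 * (n * n) * v + 1000 * (n * n) := by ring
      have hmono : 1000 * (n * n) * (v + 1) ≤ 1000 * (n * n) * (T + 1) :=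
        Nat.mul_le_mul_left _ (by omega)
      exact ⟨1000 * (n * n) * (T + 1) - 1000 * (n * n) * (v + 1),
        Or.inl ⟨h263, v + 1, hvT', h63, by omega⟩, by simp only [Expr.cost]; omega⟩
    · simp only [Expr.eval] at hf
      rcases hres with ⟨-, M, hM, hbp⟩ | ⟨h, -⟩
      swap
      · omega
      refine (runs_output hW hn k0 hM).mono ?_
      rintro t3 s3 hfr3 ⟨ht3, h263, hout⟩
      have hmul : 1000 * (n * n) * (v + 1) = 1000 * (n * n) * v + 1000 * (n * n) := by ring
      have hmono : 1000 * (n * n) * (v + 1) ≤ 1000 * (n * n) * (T + 1) :=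
        Nat.mul_le_mul_left _ (by omega)
      refine ⟨0, Or.inr ⟨h263, M, hout, v, hvT, fun m w hne h1 h2 => ?_⟩,
        by simp only [Expr.cost]; omega⟩
      rw [← g1] at h1
      rw [← g2] at h2
      have := row_le m.2
      exact (h7 _ (by omega)).2.1 (hbp m w hne h1 h2)
  · rintro t s' hfr ⟨φ', hI, hc, ht⟩
    rcases hI with ⟨h, -⟩ | ⟨-, hF⟩
    · exact absurd ((if_pos h).symm.trans hc) one_ne_zero
    · exact ⟨by simp only [Expr.cost] at ht; omega, hF⟩

theorem Instance.input_man (I : Instance n) (m w : Fin n) :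
    I.input 1 (m * n + w) = (I.man m).rank w := by
  have hlt : (m : ℕ) * n + w < n * n := by have := row_le m.2; omega
  have hw := w.2
  have h1 : Fin.divNat (⟨m * n + w, hlt⟩ : Fin (n * n)) = m := Fin.ext <| by
    simp only [Fin.coe_divNat]
    rw [mul_comm, Nat.mul_add_div (by omega), Nat.div_eq_of_lt hw, Nat.add_zero]
  have h2 : Fin.modNat (⟨m * n + w, hlt⟩ : Fin (n * n)) = w := Fin.ext <| by
    simp only [Fin.coe_modNat]
    rw [mul_comm, Nat.mul_add_mod, Nat.mod_eq_of_lt hw]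
  simp only [Instance.input, dif_pos hlt, h1, h2]

/-- The two input arrays have the same layout, so this is the case of men with the sides exchanged.
-/
theorem Instance.input_woman (I : Instance n) (w m : Fin n) :
    I.input 2 (w * n + m) = (I.woman w).rank m :=
  Instance.input_man ⟨I.woman, I.man⟩ w m

theorem Instance.mem_superBP (I : Instance n) (M : Matching n) (m w : Fin n) :
    (m, w) ∈ I.superBP M ↔ M m ≠ w ∧ I.input 1 (m * n + w) ≤ I.input 1 (m * n + M m) ∧
      I.input 2 (w * n + m) ≤ I.input 2 (w * n + M.symm w) := by
  simp only [Instance.superBP, Finset.mem_filter, Finset.mem_univ, true_and,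
    WeakPref.weakly_iff, Instance.input_man, Instance.input_woman]

/-- If exactly the super-blocking pairs of a matching are deleted, the matching is feasible. -/
theorem Instance.feasible (I : Instance n) (M : Matching n) {d : ℕ → ℕ}
    (hd : ∀ m w : Fin n, d (m * n + w) ≠ 0 ↔ (m, w) ∈ I.superBP M) :
    Feasible n (I.input 1) (I.input 2) d fun m => if h : m < n then (M ⟨m, h⟩ : ℕ) else 0 where
  lt m hm := by simp only [dif_pos hm]; exact (M ⟨m, hm⟩).2
  used m hm := by
    simp only [dif_pos hm]
    have := (hd ⟨m, hm⟩ (M ⟨m, hm⟩)).not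
    rw [I.mem_superBP, not_ne_iff] at this
    exact this.2 fun h => h.1 rfl
  block m hm m' hm' hne hf hg := by
    simp only [dif_pos hm, dif_pos hm'] at hf hg ⊢
    refine (hd ⟨m', hm'⟩ (M ⟨m, hm⟩)).2 ((I.mem_superBP _ _ _).2 ⟨?_, hf, ?_⟩)
    · exact fun h => hne (congrArg Fin.val (M.injective h))
    · simpa only [Equiv.symm_apply_apply] using hg

theorem Instance.exists_isOptimal (I : Instance n) : ∃ M, I.IsOptimal M := by
  obtain ⟨M, -, h⟩ := Finset.exists_min_image (Finset.univ : Finset (Matching n))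
    (fun M => (I.superBP M).card) ⟨Equiv.refl _, Finset.mem_univ _⟩
  exact ⟨M, fun M' => h M' (Finset.mem_univ _)⟩

/-- Sending each super-blocking pair to a position of its digit is injective, because the digit
determines the pair, and only positions below `k` carry nonzero digits. -/
theorem Instance.card_superBP_le (I : Instance n) (M : Matching n) {v k : ℕ}
    (hk : dig (n * n) v k = 0)
    (h : ∀ m w, (m, w) ∈ I.superBP M → ∃ j, dig (n * n) v j = m * n + w + 1) :
    (I.superBP M).card ≤ k := by
  choose! j hj using fun x : Fin n × Fin n => h x.1 x.2
  rw [← Finset.card_range k]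
  refine Finset.card_le_card_of_injOn j (fun x hx => ?_) fun x hx y hy hxy => ?_
  · rw [Finset.coe_range, Set.mem_Iio]
    by_contra hge
    have := dig_eq_zero_of_le (not_lt.1 hge) hk
    rw [hj x hx] at this
    omega
  · have h1 := hj x hx
    rw [hxy, hj y hy, Nat.add_right_cancel_iff] at h1
    obtain ⟨h2, h3⟩ := idx_inj y.2.2 x.2.2 h1
    exact Prod.ext (Fin.ext h2.symm) (Fin.ext h3.symm)

end

/-- Since `n + 1 ≤ 2 ^ (Nat.log 2 n + 1)`, word factor `4` makes room for `(n + 1) ^ 4`, which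
equals the left side, `16`, at `n = 1`. -/
theorem le_two_pow {n : ℕ} (hn : 1 ≤ n) :
    4 * (n * n) + 4 * n + 8 ≤ 2 ^ (4 * (Nat.log 2 n + 1)) := by
  have h : n + 1 ≤ 2 ^ (Nat.log 2 n + 1) := Nat.lt_pow_succ_log_self (by norm_num) n
  calc 4 * (n * n) + 4 * n + 8 ≤ (n + 1) ^ 4 := by nlinarith [Nat.mul_le_mul hn hn, sq_nonneg (n * n)]
    _ ≤ (2 ^ (Nat.log 2 n + 1)) ^ 4 := Nat.pow_le_pow_left h 4
    _ = _ := by rw [← pow_mul, mul_comm]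

end StableMarriage

open StableMarriage in
theorem mainTheorem8 :
    ∃ (P : RAM.Prog) (C c : ℕ), ∀ δ : ℝ, 0 ≤ δ → δ ≤ 1 →
      ∀ n : ℕ, 1 ≤ n → ∀ I : StableMarriage.Instance n, I.missing ≤ δ →
        ∃ (t : ℕ) (s : RAM.State) (M : StableMarriage.Matching n),
          RAM.Exec (c * (Nat.log 2 n + 1)) P I.input t s ∧
          StableMarriage.Outputs s M ∧
          I.IsOptimal M ∧
          t ≤ C * n ^ (2 * ((I.superBP M).card + 1)) := by
  -- The search takes at most `2000 * n ^ (2 * (k + 1)) + 5`, linking at most `70 * (n * n) + 9`;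
  -- `3000` covers the sum.
  refine ⟨.seq linkProg searchProg, 3000, 4, fun δ _ _ n hn I _ => ?_⟩
  have hW := le_two_pow hn
  obtain ⟨M₀, hM₀⟩ := I.exists_isOptimal
  obtain ⟨k, hk⟩ : ∃ k, (I.superBP M₀).card = k := ⟨_, rfl⟩
  -- the numeral of an optimal solution
  obtain ⟨l, hl⟩ : ∃ l : List ℕ, l = (I.superBP M₀).toList.map fun x => (x.1 : ℕ) * n + x.2 :=
    ⟨_, rfl⟩
  have hlen : l.length = k := by simp [hl, hk]
  have hmem : ∀ m w : Fin n, (m : ℕ) * n + w ∈ l ↔ (m, w) ∈ I.superBP M₀ := fun m w => by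
    rw [hl, List.mem_map]
    constructor
    · rintro ⟨x, hx, h⟩
      obtain ⟨h1, h2⟩ := idx_inj x.2.2 w.2 h
      rw [Finset.mem_toList] at hx
      rwa [← Fin.ext h1, ← Fin.ext h2]
    · exact fun h => ⟨(m, w), Finset.mem_toList.2 h, rfl⟩
  have hllt : ∀ a ∈ l, a < n * n := fun a ha => by
    rw [hl, List.mem_map] at ha
    obtain ⟨x, -, rfl⟩ := ha
    have := row_le x.1.2
    omega
  have hdig := dig_numeral l hllt
  obtain ⟨T, hT⟩ : ∃ T, numeral (n * n) l = T := ⟨_, rfl⟩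
  rw [hT] at hdig
  have hkn : k ≤ n * n := by
    rw [← hk]
    exact (Finset.card_le_univ _).trans (by simp)
  have hTk : dig (n * n) T k = 0 := by rw [hdig, dif_neg (by omega)]
  have hT1 : T + 1 ≤ 2 * (n * n) ^ k := by
    -- For `n = 1` the base is `1` and `numeral_bound` does not apply, but the only pair is matched,
    -- so `k = 0`.
    by_cases h1 : n = 1
    · have hk0 : k = 0 := by
        subst h1
        rw [← hk, Finset.card_eq_zero, Finset.eq_empty_iff_forall_notMem]
        rintro ⟨m, w⟩ h
        exact ((I.mem_superBP _ _ _).1 h).1 (Subsingleton.elim _ _)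
      rw [hk0, List.length_eq_zero_iff] at hlen
      rw [← hT, hlen, hk0]
      simp [numeral]
    · have := numeral_bound (N := n * n) (by nlinarith [show 2 ≤ n by omega]) l hllt
      rw [hT, hlen] at this
      omega
  have hrank : ∀ i < n * n, I.input 1 i < n ∧ I.input 2 i < n := fun i hi => by
    simp only [Instance.input, dif_pos hi]
    exact ⟨WeakPref.rank_lt _ _, WeakPref.rank_lt _ _⟩
  obtain ⟨t, s, hE, ht, hF⟩ : RAM.Runs (4 * (Nat.log 2 n + 1)) (.seq linkProg searchProg) I.input
      fun t s => t ≤ 70 * (n * n) + 9 + (1000 * (n * n) * (T + 1) + 5) ∧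
        Found n T (I.input 1) (I.input 2) s := by
    refine RAM.Runs.seq ((runs_link hW hn (by simp [Instance.input])
      (fun i hi => (hrank i hi).1) rfl rfl rfl).mono ?_)
    rintro t s hfr ⟨ht, hL⟩
    have f1 : s 1 = I.input 1 := hfr 1 (by decide)
    have f2 : s 2 = I.input 2 := hfr 2 (by decide)
    refine (runs_search (T := T) hW hn ⟨?_, ?_, ?_, ?_⟩ (by rw [hfr 6 (by decide)]; rfl)
      (by rw [hfr 26 (by decide)]; rfl)
      (dig_eq_zero_of_le hkn hTk) fun d hd => ?_).mono ?_
    · rw [hfr 0 (by decide)]; simp [Instance.input]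
    · rw [f1]; exact fun i hi => (hrank i hi).1
    · rw [f2]; exact fun i hi => (hrank i hi).2
    · rw [f1]; exact hL
    · rw [f1, f2]
      -- The nonzero digits of `T` name exactly the super-blocking pairs of `M₀`.
      refine ⟨_, I.feasible M₀ fun m w => ?_⟩
      have := row_le m.2
      rw [hd _ (by omega), ← hmem, List.mem_iff_getElem]
      refine exists_congr fun j => ?_
      rw [hdig]
      split_ifs with hj
      · simp [hj]
      · simp [hj]
    · rintro t' s' - ⟨ht', hF⟩
      rw [f1, f2] at hF
      exact ⟨by omega, hF⟩
  obtain ⟨M, hout, v, hvT, hbp⟩ := hF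
  have hle : (I.superBP M).card ≤ k := by
    refine I.card_superBP_le M (dig_mono hvT k hTk) fun m w h => ?_
    obtain ⟨h1, h2, h3⟩ := (I.mem_superBP _ _ _).1 h
    exact hbp m w (Ne.symm h1) h2 h3
  have hge : k ≤ (I.superBP M).card := hk ▸ hM₀ M
  refine ⟨t, s, M, hE, hout, fun M' => (hle.trans hk.ge).trans (hM₀ M'), ht.trans ?_⟩
  rw [le_antisymm hle hge]
  have h1 : n * n ≤ n * n * (n * n) ^ k :=
    Nat.le_mul_of_pos_right _ (pow_pos (by positivity) _)
  have h2 : 1000 * (n * n) * (T + 1) ≤ 2000 * (n * n * (n * n) ^ k) := by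
    calc _ ≤ 1000 * (n * n) * (2 * (n * n) ^ k) := Nat.mul_le_mul_left _ hT1
      _ = _ := by ring
  have h3 : n ^ (2 * (k + 1)) = n * n * (n * n) ^ k := by ring
  have h4 : 1 ≤ n * n := Nat.mul_pos hn hn
  rw [h3]
  omega
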